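/- Let $n\ge 1$ and let $\{f_h\}_{h\in(0,1)}$ be an admissible cutoff: each $f_h\in C^\infty(\mathbb{R};\mathbb{C})$, there is $\varepsilon>0$ independent of $h$ with $f_h(r)=0$ for all $r\le\varepsilon$, and for every $m\in\mathbb{N}$ there is $C_m$ with $\sup_{r}|\partial_r^m f_h(r)|\le C_m$ for all $h\in(0,1)$. For $a\in C_0^\infty(\mathbb{R}\times T^*S^{n-1};\mathbb{C})$ put $\tilde a_h(x,\xi)=f_h(r)\,a(\rho,\theta,\eta/r)$ for $x\neq0$, where $r=|x|$, $\theta=x/|x|$ and $\xi=\rho\,dr+\eta\,d\theta$ in polar coordinates, that is, $\rho=\theta\cdot\xi$ and $\eta/r\in T^*_\theta S^{n-1}$ is the restriction of $v\mapsto\xi\cdot v$ to $T_\theta S^{n-1}$; put $\tilde a_h(0,\xi)=0$. Theorem 1.1. (a) For all $h\in(0,1)$ and $a\in C_0^\infty(\mathbb{R}\times T^*S^{n-1})$ the operator $$u\mapsto \frac{1}{(2\pi)^n}\int_{\mathbb{R}^{2n}}e^{i(x-y)\cdot\xi}\,\tilde a_h\Big(\frac{h(x+y)}{2},\xi\Big)u(y)\,dy\,d\xi,\qquad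 u\in\mathcal{S}(\mathbb{R}^n),$$ extends to a (necessarily unique) bounded operator $\mathrm{Op}_{f_h}(a)$ on $L^2(\mathbb{R}^n)$. (b) Let $\{u_h\}_{h\in(0,1)}\subset L^2(\mathbb{R}^n)$ satisfy $\sup_{h\in(0,1)}\|u_h\|_{L^2}<\infty$. Then there are a sequence $h_m\in(0,1)$ with $h_m\to0$ and a finite complex Radon measure $\mu_f$ on $\mathbb{R}\times T^*S^{n-1}$ (a complex Borel measure whose total variation is finite and regular) such that $$\langle u_{h_m},\mathrm{Op}_{f_{h_m}}(a)u_{h_m}\rangle_{L^2(\mathbb{R}^n)}\to\int_{\mathbb{R}\times T^*S^{n-1}}a\,d\mu_f\qquad(m\to\infty)$$ for all $a\in C_0^\infty(\mathbb{R}\times T^*S^{n-1})$, where the inner product is linear in its second argument. If $f_h$ is real-valued for all $h\in(0,1)$, then $\mu_f$ is real (a signed measure); if $f_h\ge0$ for all $h\in(0,1)$, then $\mu_f$ is nonnegative. -/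

import Mathlib

open MeasureTheory Filter Topology
open scoped Manifold ContDiff SchwartzMap ENNReal InnerProductSpace ComplexOrder

noncomputable section

namespace DefectMeasure

/-- Euclidean space `ℝⁿ` with `n = d + 1`, so that `n ≥ 1` and the unit sphere has dimension `d`. -/
abbrev Space (d : ℕ) : Type := EuclideanSpace ℝ (Fin (d + 1))

/-- The Hilbert space `L²(ℝⁿ)` of complex-valued functions. -/
abbrev L2 (d : ℕ) : Type := Lp ℂ 2 (volume : Measure (Space d))

/-- The unit sphere `Sⁿ⁻¹ = S^d` in `ℝⁿ`. -/
abbrev UnitSphere (d : ℕ) : Type := Metric.sphere (0 : Space d) 1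

/-- The cotangent space of the sphere at `θ`: the (continuous) linear functionals on the tangent
space. -/
abbrev CotangentFiber (d : ℕ) (θ : UnitSphere d) : Type :=
  TangentSpace (𝓡 d) θ →L[ℝ] Bundle.Trivial (UnitSphere d) ℝ θ

/-- The cotangent bundle `T*Sⁿ⁻¹` with Mathlib's structure of a smooth vector bundle. -/
abbrev CotangentSphere (d : ℕ) : Type :=
  Bundle.TotalSpace (EuclideanSpace ℝ (Fin d) →L[ℝ] ℝ) (CotangentFiber d)

/-- The Borel `σ`-algebra of the cotangent bundle. -/
instance (d : ℕ) : MeasurableSpace (CotangentSphere d) := borel _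

instance (d : ℕ) : BorelSpace (CotangentSphere d) := ⟨rfl⟩

/-- The space `ℝ × T*Sⁿ⁻¹` with points `(ρ, (θ, η))`. -/
abbrev Phase (d : ℕ) : Type := ℝ × CotangentSphere d

/-- The model with corners of the manifold `ℝ × T*Sⁿ⁻¹`. -/
abbrev phaseModel (d : ℕ) :=
  𝓘(ℝ, ℝ).prod ((𝓡 d).prod 𝓘(ℝ, EuclideanSpace ℝ (Fin d) →L[ℝ] ℝ))

/-- `a ∈ C₀^∞(ℝ × T*Sⁿ⁻¹)`: complex-valued smooth functions of compact support. -/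
structure IsTestFunction {d : ℕ} (a : Phase d → ℂ) : Prop where
  smooth : ContMDiff (phaseModel d) 𝓘(ℝ, ℂ) ∞ a
  compactSupport : HasCompactSupport a

/-- Admissible cutoff functions: a family `f_h ∈ C^∞(ℝ)`, `h ∈ (0,1)`, that vanishes on `r ≤ ε` for
some `ε > 0` independent of `h`, and whose derivatives of every order are bounded uniformly in
`h`. -/
structure IsAdmissibleCutoff (f : ℝ → ℝ → ℂ) : Prop where
  smooth : ∀ h ∈ Set.Ioo (0 : ℝ) 1, ContDiff ℝ ∞ (f h)
  vanish : ∃ ε > 0, ∀ h ∈ Set.Ioo (0 : ℝ) 1, ∀ r ≤ ε, f h r = 0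
  bounded : ∀ m : ℕ, ∃ C : ℝ, ∀ h ∈ Set.Ioo (0 : ℝ) 1, ∀ r : ℝ, ‖iteratedDeriv m (f h) r‖ ≤ C

/-- The direction `x / |x|` of a nonzero vector, as a point of the sphere. -/
def direction {d : ℕ} (x : Space d) (hx : x ≠ 0) : UnitSphere d :=
  ⟨‖x‖⁻¹ • x, by simp [norm_smul, norm_ne_zero_iff.mpr hx]⟩

/-- The restriction of the covector `ξ` of `ℝⁿ` to the tangent space of the sphere at `θ`, that is,
`w ↦ ⟨ξ, dι_θ w⟩` for the inclusion `ι` of the sphere. If `ξ = ρ dr + η dθ` at `x = r θ` in polar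
coordinates, then `η w = ⟨ξ, r dι_θ w⟩`, so this is `η / r`. -/
def tangentialCovector {d : ℕ} (θ : UnitSphere d) (ξ : Space d) : CotangentFiber d θ :=
  (innerSL ℝ ξ : Space d →L[ℝ] ℝ).comp
    (mfderiv (𝓡 d) 𝓘(ℝ, Space d) (Subtype.val : UnitSphere d → Space d) θ)

/-- The symbol `(x, ξ) ↦ f(r) a(ρ, θ, η / r)` on `T*ℝⁿ`, in polar coordinates `r = |x|`,
`θ = x / |x|`, `ξ = ρ dr + η dθ` (so `ρ = ⟨θ, ξ⟩`), extended by zero to `x = 0`. -/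
def symbol {d : ℕ} (f : ℝ → ℂ) (a : Phase d → ℂ) (x ξ : Space d) : ℂ :=
  open Classical in
  if hx : x = 0 then 0
  else f ‖x‖ * a (⟪(direction x hx : Space d), ξ⟫_ℝ,
    ⟨direction x hx, tangentialCovector (direction x hx) ξ⟩)

/-- The Weyl quantization `σ^w(hx, D_x)` applied to a function `u`:
`(2π)⁻ⁿ ∫∫ exp(i (x - y)·ξ) σ(h (x + y) / 2, ξ) u(y) dy dξ`. -/
def weylIntegral {d : ℕ} (h : ℝ) (σ : Space d → Space d → ℂ) (u : Space d → ℂ) (x : Space d) : ℂ :=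
  ((2 * Real.pi : ℝ) : ℂ)⁻¹ ^ (d + 1) *
    ∫ p : Space d × Space d,
      Complex.exp (Complex.I * (⟪x - p.1, p.2⟫_ℝ : ℝ)) * σ ((h / 2) • (x + p.1)) p.2 * u p.1

/-- `T` is a bounded extension to `L²(ℝⁿ)` of the operator `σ^w(hx, D_x)` on Schwartz functions. -/
def IsWeylQuantization {d : ℕ} (h : ℝ) (σ : Space d → Space d → ℂ) (T : L2 d →L[ℂ] L2 d) : Prop :=
  ∀ u : 𝓢(Space d, ℂ), (T (u.toLp 2) : Space d → ℂ) =ᵐ[volume] weylIntegral h σ u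

/-- Since Schwartz functions are dense in `L²(ℝⁿ)`, there is at most one bounded extension. -/
theorem IsWeylQuantization.unique {d : ℕ} {h : ℝ} {σ : Space d → Space d → ℂ}
    {T T' : L2 d →L[ℂ] L2 d} (hT : IsWeylQuantization h σ T) (hT' : IsWeylQuantization h σ T') :
    T = T' := by
  have hd : DenseRange (SchwartzMap.toLpCLM ℝ ℂ 2 (volume : Measure (Space d))) :=
    SchwartzMap.denseRange_toLpCLM (by norm_num)
  have key : (T : L2 d → L2 d) = T' := by
    refine hd.equalizer T.continuous T'.continuous ?_
    funext u
    exact Lp.ext ((hT u).trans (hT' u).symm)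
  exact DFunLike.coe_injective key

/-- `Op_f(a)`: the bounded operator on `L²(ℝⁿ)` extending `ã^w(hx, D_x)` from Schwartz functions,
where `ã(x, ξ) = f(r) a(ρ, θ, η / r)` (and zero if there is no such bounded operator). -/
def Op {d : ℕ} (f : ℝ → ℂ) (h : ℝ) (a : Phase d → ℂ) : L2 d →L[ℂ] L2 d :=
  open Classical in
  if H : ∃ T, IsWeylQuantization h (symbol f a) T then H.choose else 0

end DefectMeasure

end

/-! Let `δ = √h` and test `u` against the windows `y ↦ g (δ • y - Y)`, with `g` supported in the
unit ball and `∫ g² = 1`. On such a window the rescaled position `h y = δ² y` is `δ Y` up to `O(δ)`,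
so at position `Y` the symbol is essentially frozen at `δ Y`. Hence the Weyl operator differs by
`o(1)` in operator norm from the anti-Wick operator, whose quadratic form is the integral of the
symbol at `(δ Y, ζ)` against the nonnegative density `|ℱ(g(δ · - Y) u)(ζ)|²`, of total mass `‖u‖²`.
The carriers are `exists_norm_weylKernel_sub_antiWickKernel_le`, `integral_packetMeasure` and
`packetMeasure_univ`.

The kernel estimates need smoothness and compact support of the symbol in the frequency, which give
decay of its inverse Fourier transform in `x - y`, and a uniform modulus of continuity in the
position. The same decay gives boundedness on `L²`, uniformly in `h`, by Schur's test
(`exists_kernel_operator`).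

It remains to pass to the limit in positive measures of bounded mass. The symbol is `f_h(r)` times a
function of the direction `θ` and the frequency, and `f_h` varies with `h`. As with Young measures,
the value `f_h(r)` is therefore kept as an extra coordinate: the densities are pushed to the triples
`(θ, ζ, f_h(r))`, the frequency space is compactified to a closed ball, and one weakly convergent
subsequence serves all observables (`exists_limit_complexMeasure`). Weighting the limit by its last
coordinate and discarding the mass at infinite frequency gives `μ_f`. The last coordinate lies in
the closure of the values of the `f_h`, so reality and positivity are inherited. A homeomorphism
`Sⁿ⁻¹ × ℝⁿ ≃ ℝ × T*Sⁿ⁻¹` (`polarHomeo`) carries the measure to its final space. -/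

noncomputable section

namespace DefectMeasure

/-! ### Polar coordinates on phase space. -/

section Polar

variable {d : ℕ}

/-- The differential of the inclusion of the sphere, in the coordinates of the tangent bundle
around `θ₀`. -/
def inclusionDeriv (θ₀ θ : UnitSphere d) : EuclideanSpace ℝ (Fin d) →L[ℝ] Space d :=
  inTangentCoordinates (𝓡 d) 𝓘(ℝ, Space d) id (Subtype.val : UnitSphere d → Space d)
    (mfderiv (𝓡 d) 𝓘(ℝ, Space d) (Subtype.val : UnitSphere d → Space d)) θ₀ θ

theorem contMDiff_val : ContMDiff (𝓡 d) 𝓘(ℝ, Space d) ∞ (Subtype.val : UnitSphere d → Space d) :=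
  haveI := Fact.mk (@finrank_euclideanSpace_fin ℝ _ (d + 1))
  contMDiff_coe_sphere

theorem contMDiffAt_inclusionDeriv (θ₀ : UnitSphere d) :
    ContMDiffAt (𝓡 d) 𝓘(ℝ, EuclideanSpace ℝ (Fin d) →L[ℝ] Space d) ∞ (inclusionDeriv θ₀) θ₀ :=
  (contMDiff_val.contMDiffAt (x := θ₀)).mfderiv_const (m := ∞) (by simp)

theorem inclusionDeriv_eq (θ₀ θ : UnitSphere d) :
    inclusionDeriv θ₀ θ =
      (mfderiv (𝓡 d) 𝓘(ℝ, Space d) (Subtype.val : UnitSphere d → Space d) θ).comp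
      ((trivializationAt (EuclideanSpace ℝ (Fin d)) (TangentSpace (𝓡 d)) θ₀).symmL ℝ θ) := by
  unfold inclusionDeriv inTangentCoordinates
  rw [ContinuousLinearMap.inCoordinates]
  ext1 v
  simp
  rfl

/-- A covector of the sphere in the coordinates of the cotangent bundle around `θ₀`. -/
def covectorCoord (θ₀ θ : UnitSphere d) (η : CotangentFiber d θ) :
    EuclideanSpace ℝ (Fin d) →L[ℝ] ℝ :=
  ContinuousLinearMap.inCoordinates (EuclideanSpace ℝ (Fin d)) (TangentSpace (𝓡 d)) ℝ
    (Bundle.Trivial (UnitSphere d) ℝ) θ₀ θ θ₀ θ η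

theorem covectorCoord_apply (θ₀ θ : UnitSphere d) (η : CotangentFiber d θ)
    (v : EuclideanSpace ℝ (Fin d)) :
    covectorCoord θ₀ θ η v =
      η ((trivializationAt (EuclideanSpace ℝ (Fin d)) (TangentSpace (𝓡 d)) θ₀).symmL ℝ θ v) := by
  rw [covectorCoord, ContinuousLinearMap.inCoordinates]
  simp

theorem covectorCoord_tangentialCovector (θ₀ θ : UnitSphere d) (ξ : Space d) :
    covectorCoord θ₀ θ (tangentialCovector θ ξ) =
      (innerSL ℝ ξ : Space d →L[ℝ] ℝ).comp (inclusionDeriv θ₀ θ) := by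
  ext1 v
  rw [inclusionDeriv_eq, covectorCoord_apply]
  rfl

theorem exists_symmL_eq {θ₀ θ : UnitSphere d}
    (hθ : θ ∈ (chartAt (EuclideanSpace ℝ (Fin d)) θ₀).source) (w : TangentSpace (𝓡 d) θ) :
    ∃ v, (trivializationAt (EuclideanSpace ℝ (Fin d)) (TangentSpace (𝓡 d)) θ₀).symmL ℝ θ v = w :=
  ⟨_, Bundle.Trivialization.symmL_continuousLinearMapAt _ (by simpa using hθ) w⟩

theorem covectorCoord_injective {θ₀ θ : UnitSphere d}
    (hθ : θ ∈ (chartAt (EuclideanSpace ℝ (Fin d)) θ₀).source) :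
    Function.Injective (covectorCoord θ₀ θ) := by
  intro η η' h
  refine ContinuousLinearMap.ext fun w => ?_
  obtain ⟨v, rfl⟩ := exists_symmL_eq hθ w
  simpa only [covectorCoord_apply] using DFunLike.congr_fun h v

/-- The point of `ℝ × T*Sⁿ⁻¹` with the polar coordinates of a covector `ξ` of `ℝⁿ` at a point with
direction `θ`. -/
def polar (q : UnitSphere d × Space d) : Phase d :=
  (⟪(q.1 : Space d), q.2⟫_ℝ, ⟨q.1, tangentialCovector q.1 q.2⟩)

/-- Smoothness into the cotangent bundle is tested in a local trivialization, where the tangential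
covector becomes `ξ` composed with the coordinate expression of the differential of the inclusion.
-/
theorem contMDiff_polar :
    ContMDiff ((𝓡 d).prod 𝓘(ℝ, Space d)) (phaseModel d) ∞ (polar (d := d)) := by
  have h1 : ContMDiff ((𝓡 d).prod 𝓘(ℝ, Space d)) 𝓘(ℝ, Space d) ∞
      (fun q : UnitSphere d × Space d => (q.1 : Space d)) := contMDiff_val.comp contMDiff_fst
  refine ContMDiff.prodMk ?_ ?_
  · exact (contDiff_inner (𝕜 := ℝ)).contMDiff.comp (h1.prodMk_space contMDiff_snd)
  intro q₀
  rw [contMDiffAt_hom_bundle]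
  refine ⟨contMDiff_fst.contMDiffAt, ?_⟩
  have h2 : ContMDiffAt ((𝓡 d).prod 𝓘(ℝ, Space d)) 𝓘(ℝ, EuclideanSpace ℝ (Fin d) →L[ℝ] ℝ) ∞
      (fun q : UnitSphere d × Space d =>
        (innerSL ℝ q.2 : Space d →L[ℝ] ℝ).comp (inclusionDeriv q₀.1 q.1)) q₀ := by
    refine ContMDiffAt.clm_comp ?_ ?_
    · exact ((innerSL ℝ).contDiff.contMDiff.comp contMDiff_snd).contMDiffAt
    · exact (contMDiffAt_inclusionDeriv q₀.1).comp q₀ contMDiff_fst.contMDiffAt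
  exact h2.congr_of_eventuallyEq
    (.of_forall fun q => covectorCoord_tangentialCovector q₀.1 q.1 q.2)

/-- The linear map that sends a covector `ξ` of `ℝⁿ` to the coordinates of its polar
components. -/
def polarCoord (θ₀ θ : UnitSphere d) : Space d →L[ℝ] ℝ × (EuclideanSpace ℝ (Fin d) →L[ℝ] ℝ) :=
  (innerSL ℝ (θ : Space d) : Space d →L[ℝ] ℝ).prod
    (((ContinuousLinearMap.compL ℝ (EuclideanSpace ℝ (Fin d)) (Space d) ℝ).flip
      (inclusionDeriv θ₀ θ)).comp (innerSL ℝ))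

theorem polarCoord_apply (θ₀ θ : UnitSphere d) (ξ : Space d) :
    polarCoord θ₀ θ ξ = (⟪(θ : Space d), ξ⟫_ℝ, covectorCoord θ₀ θ (tangentialCovector θ ξ)) := by
  rw [covectorCoord_tangentialCovector]
  rfl

theorem continuousAt_polarCoord (θ₀ : UnitSphere d) : ContinuousAt (polarCoord θ₀) θ₀ := by
  have h1 : ContinuousAt (inclusionDeriv θ₀) θ₀ := (contMDiffAt_inclusionDeriv θ₀).continuousAt
  have h2 : ContinuousAt (fun θ : UnitSphere d => (innerSL ℝ (θ : Space d) : Space d →L[ℝ] ℝ)) θ₀ :=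
    by fun_prop
  have h3 : ContinuousAt (fun θ : UnitSphere d =>
      ((ContinuousLinearMap.compL ℝ (EuclideanSpace ℝ (Fin d)) (Space d) ℝ).flip
      (inclusionDeriv θ₀ θ)).comp (innerSL ℝ : Space d →L[ℝ] Space d →L[ℝ] ℝ)) θ₀ := by fun_prop
  exact (ContinuousLinearMap.prodₗᵢ (𝕜 := ℝ) (E := Space d) (F := ℝ)
    (G := EuclideanSpace ℝ (Fin d) →L[ℝ] ℝ) ℝ).continuous.continuousAt.comp (h2.prodMk h3)

/-- Vanishing radial component puts `ξ` in `θ^⊥`, which is the range of the differential of the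
inclusion. Vanishing tangential component then makes `ξ` orthogonal to itself. -/
theorem polarCoord_injective {θ₀ θ : UnitSphere d}
    (hθ : θ ∈ (chartAt (EuclideanSpace ℝ (Fin d)) θ₀).source) :
    Function.Injective (polarCoord θ₀ θ) := by
  have := Fact.mk (@finrank_euclideanSpace_fin ℝ _ (d + 1))
  refine (injective_iff_map_eq_zero (polarCoord θ₀ θ)).2 fun ξ h => ?_
  rw [polarCoord_apply, Prod.mk_eq_zero] at h
  have hmem : ξ ∈ (ℝ ∙ (θ : Space d))ᗮ := Submodule.mem_orthogonal_singleton_iff_inner_right.2 h.1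
  rw [← range_mvfderiv_subtypeVal (n := d)] at hmem
  obtain ⟨w, hw⟩ := hmem
  obtain ⟨v, rfl⟩ := exists_symmL_eq hθ w
  have h2 := DFunLike.congr_fun h.2 v
  rw [covectorCoord_apply] at h2
  have h3 : ⟪ξ, ξ⟫_ℝ = 0 := by
    nth_rewrite 2 [← hw]
    exact h2
  exact inner_self_eq_zero.1 h3

/-- `polarCoord` as a linear equivalence. -/
def polarCoordEquiv {θ₀ θ : UnitSphere d}
    (hθ : θ ∈ (chartAt (EuclideanSpace ℝ (Fin d)) θ₀).source) :
    Space d ≃L[ℝ] ℝ × (EuclideanSpace ℝ (Fin d) →L[ℝ] ℝ) :=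
  (LinearMap.linearEquivOfInjective (polarCoord θ₀ θ : Space d →ₗ[ℝ] _) (polarCoord_injective hθ)
    (by
      have h : Module.finrank ℝ (EuclideanSpace ℝ (Fin d) →L[ℝ] ℝ) = d := by
        rw [← (InnerProductSpace.toDual ℝ (EuclideanSpace ℝ (Fin d))).toLinearEquiv.finrank_eq]
        simp
      rw [Module.finrank_prod, h]
      simp [add_comm])).toContinuousLinearEquiv

theorem coe_polarCoordEquiv {θ₀ θ : UnitSphere d}
    (hθ : θ ∈ (chartAt (EuclideanSpace ℝ (Fin d)) θ₀).source) :
    (polarCoordEquiv hθ : Space d →L[ℝ] _) = polarCoord θ₀ θ := by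
  ext1 ξ
  rfl

theorem bijective_polar : Function.Bijective (polar (d := d)) := by
  constructor
  · rintro ⟨θ, ξ⟩ ⟨θ', ξ'⟩ h
    obtain rfl : θ = θ' := congrArg (fun p : Phase d => p.2.1) h
    have h2 := congrArg (fun p : Phase d => (p.1, covectorCoord θ p.2.1 p.2.2)) h
    have h3 : polarCoord θ θ ξ = polarCoord θ θ ξ' := by
      rw [polarCoord_apply, polarCoord_apply]
      exact h2
    rw [polarCoord_injective (mem_chart_source _ θ) h3]
  · rintro ⟨ρ, θ, η⟩
    have hθ := mem_chart_source (EuclideanSpace ℝ (Fin d)) θ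
    have h := (polarCoordEquiv hθ).apply_symm_apply (ρ, covectorCoord θ θ η)
    set ξ := (polarCoordEquiv hθ).symm (ρ, covectorCoord θ θ η)
    have h' : polarCoord θ θ ξ = (ρ, covectorCoord θ θ η) := h
    rw [polarCoord_apply, Prod.mk.injEq] at h'
    refine ⟨(θ, ξ), ?_⟩
    have h4 := covectorCoord_injective hθ h'.2
    rw [polar]
    simp only [h'.1, h4]

/-- Near a fixed direction `θ₀` the inverse is obtained by inverting the linear map `polarCoord θ₀
θ`. This map is continuous in `θ` at `θ₀`, and inversion of continuous linear maps is continuous at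
an invertible one. -/
theorem continuous_polar_inv :
    Continuous (Equiv.ofBijective (polar (d := d)) bijective_polar).symm := by
  set e := Equiv.ofBijective (polar (d := d)) bijective_polar
  have he1 : ∀ p, (e.symm p).1 = p.2.1 := fun p =>
    congrArg (fun p : Phase d => p.2.1) (e.apply_symm_apply p)
  have hfst : Continuous fun p : Phase d => p.2.1 :=
    (FiberBundle.continuous_proj (EuclideanSpace ℝ (Fin d) →L[ℝ] ℝ) (CotangentFiber d)).comp
      continuous_snd
  refine continuous_iff_continuousAt.2 fun p₀ => ?_
  set θ₀ := p₀.2.1 with hθ₀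
  have h1 : ContinuousAt (fun p : Phase d => polarCoord θ₀ p.2.1) p₀ :=
    ContinuousAt.comp (f := fun p : Phase d => p.2.1) (continuousAt_polarCoord θ₀)
      hfst.continuousAt
  have h2 : ContinuousAt (fun p : Phase d => covectorCoord θ₀ p.2.1 p.2.2) p₀ :=
    ((continuousAt_hom_bundle (RingHom.id ℝ) _).1
      (continuous_snd (X := ℝ) (Y := CotangentSphere d)).continuousAt).2
  have h3 : ContinuousAt (ContinuousLinearMap.inverse (R := ℝ) (M := Space d)
      (M₂ := ℝ × (EuclideanSpace ℝ (Fin d) →L[ℝ] ℝ))) (polarCoord θ₀ θ₀) := by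
    rw [← coe_polarCoordEquiv (mem_chart_source (EuclideanSpace ℝ (Fin d)) θ₀)]
    exact (contDiffAt_map_inverse (n := 0) _).continuousAt
  have h4 : ContinuousAt (fun p : Phase d => (polarCoord θ₀ p.2.1).inverse
      (p.1, covectorCoord θ₀ p.2.1 p.2.2)) p₀ :=
    (ContinuousAt.comp (f := fun p : Phase d => polarCoord θ₀ p.2.1) h3 h1).clm_apply
      (continuousAt_fst.prodMk h2)
  have h5 : ∀ᶠ p : Phase d in 𝓝 p₀, p.2.1 ∈ (chartAt (EuclideanSpace ℝ (Fin d)) θ₀).source :=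
    hfst.continuousAt.eventually_mem (chart_source_mem_nhds _ _)
  refine (hfst.continuousAt.prodMk h4).congr ?_
  filter_upwards [h5] with p hp
  refine Prod.ext (he1 p).symm ?_
  have h6 : polarCoord θ₀ p.2.1 (e.symm p).2 = (p.1, covectorCoord θ₀ p.2.1 p.2.2) := by
    obtain ⟨⟨θ, ξ⟩, rfl⟩ := e.surjective p
    rw [e.symm_apply_apply]
    exact polarCoord_apply _ _ _
  change (polarCoord θ₀ p.2.1).inverse (p.1, covectorCoord θ₀ p.2.1 p.2.2) = _
  rw [← h6, ← coe_polarCoordEquiv hp, ContinuousLinearMap.inverse_equiv]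
  exact (polarCoordEquiv hp).symm_apply_apply _

/-- Polar coordinates as a homeomorphism. -/
def polarHomeo (d : ℕ) : UnitSphere d × Space d ≃ₜ Phase d where
  toEquiv := Equiv.ofBijective polar bijective_polar
  continuous_toFun := contMDiff_polar.continuous
  continuous_invFun := continuous_polar_inv

end Polar

/-! ### Uniform estimates on the symbols. -/

section SymbolBounds

theorem norm_iteratedFDeriv_partial_le {E F G : Type*} [NormedAddCommGroup E] [NormedSpace ℝ E]
    [NormedAddCommGroup F] [NormedSpace ℝ F] [NormedAddCommGroup G] [NormedSpace ℝ G]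
    {B : E × F → G} (hB : ContDiff ℝ ∞ B) (j : ℕ) (x : E) (y : F) :
    ‖iteratedFDeriv ℝ j (fun y => B (x, y)) y‖ ≤ ‖iteratedFDeriv ℝ j B (x, y)‖ := by
  have h1 : (fun y => B (x, y)) =
      (fun p => B ((x, 0) + p)) ∘ (ContinuousLinearMap.inr ℝ E F) := by
    ext y
    simp
  have h2 : ContDiff ℝ ∞ fun p => B ((x, 0) + p) := hB.comp (contDiff_const.add contDiff_id)
  rw [h1, ContinuousLinearMap.iteratedFDeriv_comp_right _ h2 _ (by exact_mod_cast le_top),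
    iteratedFDeriv_comp_add_left]
  refine (ContinuousMultilinearMap.norm_compContinuousLinearMap_le _ _).trans ?_
  have h3 : ∏ _i : Fin j, ‖ContinuousLinearMap.inr ℝ E F‖ ≤ 1 :=
    Finset.prod_le_one (fun _ _ => norm_nonneg _) fun _ _ =>
      ContinuousLinearMap.norm_inr_le_one ℝ E F
  simpa using mul_le_mul_of_nonneg_left h3 (norm_nonneg (iteratedFDeriv ℝ j B (x, y)))

variable {d : ℕ}

theorem exists_norm_eq_zero_of_hasCompactSupport {S V : Type*} [TopologicalSpace S]
    [NormedAddCommGroup V] {G : S × V → ℂ} (hc : HasCompactSupport G) :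
    ∃ R, 0 < R ∧ ∀ θ ξ, R < ‖ξ‖ → G (θ, ξ) = 0 := by
  obtain ⟨R, hR⟩ := ((hc.image continuous_snd).isBounded).exists_norm_le
  refine ⟨max R 1, by positivity, fun θ ξ hξ => ?_⟩
  by_contra h
  exact absurd (hR ξ ⟨(θ, ξ), subset_tsupport _ h, rfl⟩)
    (not_le.2 (lt_of_le_of_lt (le_max_left _ _) hξ))

/-- The stereographic chart has the whole model space as target, so its inverse is smooth globally
and no restriction to a chart domain is needed. -/
theorem contDiff_chart_comp {G : UnitSphere d × Space d → ℂ}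
    (hG : ContMDiff ((𝓡 d).prod 𝓘(ℝ, Space d)) 𝓘(ℝ, ℂ) ∞ G) (θ₀ : UnitSphere d) :
    ContDiff ℝ ∞ fun p : EuclideanSpace ℝ (Fin d) × Space d =>
      G ((chartAt (EuclideanSpace ℝ (Fin d)) θ₀).symm p.1, p.2) := by
  have h1 : ContMDiff (𝓡 d) (𝓡 d) ∞ (chartAt (EuclideanSpace ℝ (Fin d)) θ₀).symm := by
    have h := contMDiffOn_chart_symm (I := 𝓡 d) (n := ∞) (x := θ₀)
    have ht : (chartAt (EuclideanSpace ℝ (Fin d)) θ₀).target = Set.univ :=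
      have := Fact.mk (@finrank_euclideanSpace_fin ℝ _ (d + 1))
      stereographic'_target (-θ₀)
    rwa [ht, contMDiffOn_univ] at h
  have h2 : ContMDiff ((𝓡 d).prod 𝓘(ℝ, Space d)) 𝓘(ℝ, ℂ) ∞
      fun p : EuclideanSpace ℝ (Fin d) × Space d =>
      G ((chartAt (EuclideanSpace ℝ (Fin d)) θ₀).symm p.1, p.2) :=
    hG.comp ((h1.comp contMDiff_fst).prodMk contMDiff_snd)
  rw [← modelWithCornersSelf_prod, chartedSpaceSelf_prod] at h2
  exact h2.contDiff

theorem contDiff_fiber {G : UnitSphere d × Space d → ℂ}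
    (hG : ContMDiff ((𝓡 d).prod 𝓘(ℝ, Space d)) 𝓘(ℝ, ℂ) ∞ G) (θ : UnitSphere d) :
    ContDiff ℝ ∞ fun ξ => G (θ, ξ) :=
  (hG.comp (contMDiff_const.prodMk contMDiff_id)).contDiff

/-- In a chart a fibre derivative is bounded by a full derivative on flat space, which is bounded on
compact sets. Finitely many such neighbourhoods cover the sphere. -/
theorem exists_norm_iteratedFDeriv_le {G : UnitSphere d × Space d → ℂ}
    (hG : ContMDiff ((𝓡 d).prod 𝓘(ℝ, Space d)) 𝓘(ℝ, ℂ) ∞ G) (hc : HasCompactSupport G) (j : ℕ) :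
    ∃ C, 0 ≤ C ∧ ∀ θ ξ, ‖iteratedFDeriv ℝ j (fun ξ => G (θ, ξ)) ξ‖ ≤ C := by
  obtain ⟨R, -, hR⟩ := exists_norm_eq_zero_of_hasCompactSupport hc
  have hout : ∀ θ ξ, R < ‖ξ‖ → iteratedFDeriv ℝ j (fun ξ => G (θ, ξ)) ξ = 0 := by
    intro θ ξ hξ
    have h1 : (fun ξ => G (θ, ξ)) =ᶠ[𝓝 ξ] 0 := by
      filter_upwards [continuous_norm.continuousAt.eventually (lt_mem_nhds hξ)] with ξ' h
      exact hR θ ξ' h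
    rw [(h1.iteratedFDeriv ℝ j).eq_of_nhds]
    simp
  have hloc : ∀ θ₀ : UnitSphere d, ∃ t ∈ 𝓝 θ₀, ∃ C, 0 ≤ C ∧ ∀ θ ∈ t, ∀ ξ,
      ‖iteratedFDeriv ℝ j (fun ξ => G (θ, ξ)) ξ‖ ≤ C := by
    intro θ₀
    set φ := chartAt (EuclideanSpace ℝ (Fin d)) θ₀
    have hB := contDiff_chart_comp hG θ₀
    have hcont := (hB.continuous_iteratedFDeriv (m := j) (by exact_mod_cast le_top)).norm
    obtain ⟨C, hC⟩ := ((isCompact_closedBall (φ θ₀) 1).prod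
      (isCompact_closedBall (0 : Space d) R)).bddAbove_image hcont.continuousOn
    refine ⟨φ.source ∩ φ ⁻¹' Metric.closedBall (φ θ₀) 1, inter_mem (chart_source_mem_nhds _ _)
      ((φ.continuousAt (mem_chart_source _ θ₀)).preimage_mem_nhds
        (Metric.closedBall_mem_nhds _ one_pos)), max C 0, le_max_right _ _, ?_⟩
    rintro θ ⟨hθ, hθ'⟩ ξ
    rcases lt_or_ge R ‖ξ‖ with hξ | hξ
    · simp [hout θ ξ hξ]
    have h1 := norm_iteratedFDeriv_partial_le hB j (φ θ) ξ
    have h2 : φ.symm (φ θ) = θ := φ.left_inv hθ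
    simp only [φ] at h2
    simp only [φ, h2] at h1
    refine h1.trans (le_max_of_le_left (hC ⟨(φ θ, ξ), ⟨hθ', ?_⟩, rfl⟩))
    simpa using hξ
  choose t ht C hC0 hC using hloc
  obtain ⟨s, -, hs⟩ := isCompact_univ.elim_nhds_subcover t fun θ _ => ht θ
  refine ⟨∑ θ ∈ s, C θ, Finset.sum_nonneg fun θ _ => hC0 θ, fun θ ξ => ?_⟩
  obtain ⟨θ₀, h0, hθ⟩ := Set.mem_iUnion₂.1 (hs (Set.mem_univ θ))
  exact (hC θ₀ θ hθ ξ).trans (Finset.single_le_sum (fun θ _ => hC0 θ) h0)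

/-- At distance at least `η` the trivial bound `2B` is absorbed by a linear term of slope `2B / η`.
A modulus that is linear up to `ε` is convenient because it can later be weighted by `1 + ‖z‖`. -/
theorem exists_dist_le_add_mul {α : Type*} [PseudoMetricSpace α] {G : α → ℂ}
    (hc : UniformContinuous G) {B : ℝ} (hB : ∀ q, ‖G q‖ ≤ B) {ε : ℝ} (hε : 0 < ε) :
    ∃ C, 0 ≤ C ∧ ∀ q q', ‖G q - G q'‖ ≤ ε + C * dist q q' := by
  obtain ⟨η, hη, h⟩ := Metric.uniformContinuous_iff.1 hc ε hε
  refine ⟨2 * max B 0 / η, by positivity, fun q q' => ?_⟩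
  rcases lt_or_ge (dist q q') η with hq | hq
  · have := h hq
    rw [dist_eq_norm] at this
    have : 0 ≤ 2 * max B 0 / η * dist q q' := by positivity
    linarith
  · have h1 : ‖G q - G q'‖ ≤ 2 * max B 0 :=
      (norm_sub_le _ _).trans (by linarith [hB q, hB q', le_max_left B 0])
    have h2 : 2 * max B 0 ≤ 2 * max B 0 / η * dist q q' := by
      rw [div_mul_eq_mul_div, le_div_iff₀ hη]
      gcongr
    linarith

/-- The direction `x / |x|`, with an arbitrary value at `x = 0`. -/
def unitDir (x : Space d) : UnitSphere d :=
  open Classical in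
  if hx : x = 0 then ⟨EuclideanSpace.single 0 1, by simp⟩ else direction x hx

theorem coe_unitDir {x : Space d} (hx : x ≠ 0) : (unitDir x : Space d) = ‖x‖⁻¹ • x := by
  rw [unitDir, dif_neg hx]
  rfl

theorem continuousOn_unitDir : ContinuousOn (unitDir (d := d)) {0}ᶜ := by
  rw [Topology.IsInducing.subtypeVal.continuousOn_iff]
  have h : ContinuousOn (fun x : Space d => ‖x‖⁻¹ • x) {0}ᶜ :=
    (continuous_norm.continuousOn.inv₀ fun x hx => norm_ne_zero_iff.2 hx).smul continuousOn_id
  exact h.congr fun x hx => coe_unitDir hx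

theorem measurable_unitDir : Measurable (unitDir (d := d)) :=
  measurable_of_continuousOn_compl_singleton 0 continuousOn_unitDir

theorem dist_unitDir_le {x y : Space d} {ε : ℝ} (hε : 0 < ε) (hx : ε ≤ ‖x‖) (hy : ε ≤ ‖y‖) :
    dist (unitDir x) (unitDir y) ≤ 2 / ε * ‖x - y‖ := by
  have hx0 : 0 < ‖x‖ := hε.trans_le hx
  have hy0 : 0 < ‖y‖ := hε.trans_le hy
  rw [Subtype.dist_eq, coe_unitDir (norm_pos_iff.1 hx0), coe_unitDir (norm_pos_iff.1 hy0),
    dist_eq_norm]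
  have h1 : ‖x‖⁻¹ • x - ‖y‖⁻¹ • y = ‖x‖⁻¹ • (x - y) + (‖x‖⁻¹ * ((‖y‖ - ‖x‖) * ‖y‖⁻¹)) • y := by
    rw [show ‖x‖⁻¹ * ((‖y‖ - ‖x‖) * ‖y‖⁻¹) = ‖x‖⁻¹ - ‖y‖⁻¹ by field_simp, smul_sub, sub_smul]
    abel
  have h2 : |‖y‖ - ‖x‖| ≤ ‖x - y‖ := by
    rw [abs_sub_comm]
    exact abs_norm_sub_norm_le x y
  rw [h1]
  calc _ ≤ ‖x‖⁻¹ * ‖x - y‖ + ‖x‖⁻¹ * (|‖y‖ - ‖x‖| * ‖y‖⁻¹) * ‖y‖ := by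
        refine (norm_add_le _ _).trans (le_of_eq ?_)
        simp [norm_smul]
    _ = ‖x‖⁻¹ * ‖x - y‖ + ‖x‖⁻¹ * |‖y‖ - ‖x‖| := by field_simp
    _ ≤ ε⁻¹ * ‖x - y‖ + ε⁻¹ * ‖x - y‖ := by gcongr
    _ = _ := by ring

theorem symbol_eq {f : ℝ → ℂ} (hf : f 0 = 0) (a : Phase d → ℂ) (x ξ : Space d) :
    symbol f a x ξ = f ‖x‖ * a (polar (unitDir x, ξ)) := by
  unfold symbol
  split_ifs with hx
  · simp [hx, hf]
  · rw [unitDir, dif_neg hx]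
    rfl

theorem IsAdmissibleCutoff.exists_bound {f : ℝ → ℝ → ℂ} (hf : IsAdmissibleCutoff f) :
    ∃ M, 0 ≤ M ∧ ∀ h ∈ Set.Ioo (0 : ℝ) 1, ∀ r, ‖f h r‖ ≤ M := by
  obtain ⟨M, hM⟩ := hf.bounded 0
  refine ⟨max M 0, le_max_right _ _, fun h hh r => le_max_of_le_left ?_⟩
  simpa using hM h hh r

theorem IsAdmissibleCutoff.exists_lipschitz {f : ℝ → ℝ → ℂ} (hf : IsAdmissibleCutoff f) :
    ∃ M, 0 ≤ M ∧ ∀ h ∈ Set.Ioo (0 : ℝ) 1, ∀ r s, ‖f h r - f h s‖ ≤ M * |r - s| := by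
  obtain ⟨M, hM⟩ := hf.bounded 1
  refine ⟨max M 0, le_max_right _ _, fun h hh r s => ?_⟩
  refine Convex.norm_image_sub_le_of_norm_deriv_le (s := Set.univ) (f := f h)
    (fun x _ => ((hf.smooth h hh).differentiable (by simp)).differentiableAt) (fun x _ => ?_)
    convex_univ (Set.mem_univ s) (Set.mem_univ r)
  have := hM h hh x
  rw [iteratedDeriv_one] at this
  exact le_max_of_le_left this

theorem IsAdmissibleCutoff.map_zero {f : ℝ → ℝ → ℂ} (hf : IsAdmissibleCutoff f) {h : ℝ}
    (hh : h ∈ Set.Ioo (0 : ℝ) 1) : f h 0 = 0 := by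
  obtain ⟨ε, hε, h0⟩ := hf.vanish
  exact h0 h hh 0 hε.le

/-- A family of symbols `s i X ζ` with compact support in `ζ`, uniformly bounded derivatives in `ζ`
and a common modulus of continuity in `X`. -/
structure UniformSymbol {ι V : Type*} [NormedAddCommGroup V] [InnerProductSpace ℝ V]
    (s : ι → V → V → ℂ) : Prop where
  continuous : ∀ i, Continuous (Function.uncurry (s i))
  smooth : ∀ i X, ContDiff ℝ ∞ (s i X)
  support : ∃ R, ∀ i X ζ, R < ‖ζ‖ → s i X ζ = 0
  bound : ∀ j, ∃ C, ∀ i X ζ, ‖iteratedFDeriv ℝ j (s i X) ζ‖ ≤ C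
  modulus : ∀ ε > 0, ∃ C, 0 ≤ C ∧ ∀ i X X' ζ, ‖s i X ζ - s i X' ζ‖ ≤ ε + C * ‖X - X'‖

theorem uniformSymbol_mul {f : ℝ → ℝ → ℂ} (hf : IsAdmissibleCutoff f)
    {G : UnitSphere d × Space d → ℂ}
    (hG : ContMDiff ((𝓡 d).prod 𝓘(ℝ, Space d)) 𝓘(ℝ, ℂ) ∞ G) (hc : HasCompactSupport G) :
    UniformSymbol fun (h : Set.Ioo (0 : ℝ) 1) (X ζ : Space d) =>
      f h ‖X‖ * G (unitDir X, ζ) := by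
  obtain ⟨M, hM0, hM⟩ := hf.exists_bound
  obtain ⟨L, hL0, hL⟩ := hf.exists_lipschitz
  obtain ⟨ε₀, hε₀, hvan⟩ := hf.vanish
  obtain ⟨B, hB⟩ := hc.exists_bound_of_continuous hG.continuous
  have hB0 : 0 ≤ B := (norm_nonneg _).trans (hB (unitDir 0, 0))
  refine ⟨fun h => ?_, fun h X => contDiff_const.mul (contDiff_fiber hG _), ?_, fun j => ?_,
    fun ε hε => ?_⟩
  · refine continuous_iff_continuousAt.2 fun ⟨X₀, ζ₀⟩ => ?_
    -- The direction is discontinuous at the origin, but the cutoff vanishes on a whole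
    -- neighbourhood of it.
    rcases eq_or_ne X₀ 0 with rfl | hX
    · have : (fun _ => (0 : ℂ)) =ᶠ[𝓝 ((0 : Space d), ζ₀)]
          Function.uncurry fun X ζ => f h ‖X‖ * G (unitDir X, ζ) := by
        have h1 : ∀ᶠ p : Space d × Space d in 𝓝 (0, ζ₀), ‖p.1‖ < ε₀ :=
          (continuous_fst.norm.continuousAt
            (x := ((0 : Space d), ζ₀))).eventually_lt_const (by simpa)
        filter_upwards [h1] with p hp
        simp [Function.uncurry, hvan h h.2 _ hp.le]
      exact continuousAt_const.congr this
    · refine ContinuousAt.mul ?_ (hG.continuous.continuousAt.comp ?_)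
      · exact ((hf.smooth h h.2).continuous.comp continuous_fst.norm).continuousAt
      · have h1 : ContinuousAt unitDir X₀ :=
          continuousOn_unitDir.continuousAt (isOpen_compl_singleton.mem_nhds hX)
        exact (ContinuousAt.comp (x := (X₀, ζ₀)) (f := Prod.fst) h1 continuousAt_fst).prodMk
          continuousAt_snd
  · obtain ⟨R, -, hR⟩ := exists_norm_eq_zero_of_hasCompactSupport hc
    exact ⟨R, fun h X ζ hζ => by simp [hR _ _ hζ]⟩
  · obtain ⟨C, hC0, hC⟩ := exists_norm_iteratedFDeriv_le hG hc j
    refine ⟨M * C, fun h X ζ => ?_⟩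
    have h1 : (fun ζ => f h ‖X‖ * G (unitDir X, ζ)) = f h ‖X‖ • fun ζ => G (unitDir X, ζ) := rfl
    rw [h1, iteratedFDeriv_const_smul_apply
      ((contDiff_fiber hG _).contDiffAt.of_le (by exact_mod_cast le_top)), norm_smul]
    exact mul_le_mul (hM h h.2 _) (hC _ _) (norm_nonneg _) hM0
  · obtain ⟨C, hC0, hC⟩ := exists_dist_le_add_mul
      (hc.uniformContinuous_of_continuous hG.continuous) hB (ε := ε / (M + 1)) (by positivity)
    refine ⟨L * B + M * (C * (2 / ε₀)), by positivity, fun h => ?_⟩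
    have hMε : M * (ε / (M + 1)) ≤ ε := by
      rw [mul_div_assoc', div_le_iff₀ (by positivity)]
      nlinarith
    -- With `X'` the shorter vector, either the cutoff vanishes at `X'` and only its Lipschitz bound
    -- is needed, or both vectors have length at least `ε₀`, where the direction is Lipschitz.
    have key : ∀ X X' ζ, ‖X'‖ ≤ ‖X‖ → ‖f h ‖X‖ * G (unitDir X, ζ) - f h ‖X'‖ * G (unitDir X', ζ)‖
        ≤ ε + (L * B + M * (C * (2 / ε₀))) * ‖X - X'‖ := by
      intro X X' ζ hXX
      have hf1 : ‖f h ‖X‖ - f h ‖X'‖‖ ≤ L * ‖X - X'‖ :=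
        (hL h h.2 _ _).trans (by gcongr; exact abs_norm_sub_norm_le X X')
      have h2 : 0 ≤ M * (C * (2 / ε₀)) * ‖X - X'‖ := by positivity
      have h3 : f h ‖X‖ * G (unitDir X, ζ) - f h ‖X'‖ * G (unitDir X', ζ) =
          (f h ‖X‖ - f h ‖X'‖) * G (unitDir X, ζ) +
            f h ‖X'‖ * (G (unitDir X, ζ) - G (unitDir X', ζ)) := by ring
      have h4 : ‖(f h ‖X‖ - f h ‖X'‖) * G (unitDir X, ζ)‖ ≤ L * ‖X - X'‖ * B := by
        rw [norm_mul]
        exact mul_le_mul hf1 (hB _) (norm_nonneg _) (by positivity)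
      rcases le_or_gt ‖X'‖ ε₀ with hX' | hX'
      · rw [h3, hvan h h.2 _ hX', sub_zero, zero_mul, add_zero]
        rw [hvan h h.2 _ hX', sub_zero] at h4
        linarith
      · have h5 : dist (unitDir X, ζ) (unitDir X', ζ) ≤ 2 / ε₀ * ‖X - X'‖ := by
          rw [Prod.dist_eq, dist_self, max_eq_left dist_nonneg]
          exact dist_unitDir_le hε₀ (hX'.le.trans hXX) hX'.le
        have h6 : ‖f h ‖X'‖ * (G (unitDir X, ζ) - G (unitDir X', ζ))‖ ≤
            M * (ε / (M + 1) + C * (2 / ε₀ * ‖X - X'‖)) := by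
          rw [norm_mul]
          exact mul_le_mul (hM h h.2 _) ((hC _ _).trans (by gcongr)) (norm_nonneg _) hM0
        rw [h3]
        refine (norm_add_le _ _).trans ?_
        linarith
    intro X X' ζ
    rcases le_total ‖X'‖ ‖X‖ with hXX | hXX
    · exact key X X' ζ hXX
    · rw [norm_sub_rev, norm_sub_rev X]
      exact key X' X ζ hXX

/-- The symbol of `Op`, in the frequency variable `ξ / 2π`. -/
def scaledSymbol (f : ℝ → ℂ) (a : Phase d → ℂ) (X ζ : Space d) : ℂ :=
  symbol f a X ((2 * Real.pi) • ζ)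

/-- The polar coordinates of `2πζ` at a point with direction `θ`. -/
def scaledPolar (d : ℕ) : UnitSphere d × Space d ≃ₜ Phase d :=
  ((Homeomorph.refl _).prodCongr (Homeomorph.smulOfNeZero (2 * Real.pi) (by positivity))).trans
    (polarHomeo d)

theorem scaledSymbol_eq {f : ℝ → ℂ} (hf : f 0 = 0) (a : Phase d → ℂ) (X ζ : Space d) :
    scaledSymbol f a X ζ = f ‖X‖ * a (scaledPolar d (unitDir X, ζ)) :=
  symbol_eq hf a _ _

theorem uniformSymbol_scaledSymbol {f : ℝ → ℝ → ℂ} (hf : IsAdmissibleCutoff f)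
    {a : Phase d → ℂ} (ha : IsTestFunction a) :
    UniformSymbol fun h : Set.Ioo (0 : ℝ) 1 => scaledSymbol (f h) a := by
  have h1 : ContMDiff ((𝓡 d).prod 𝓘(ℝ, Space d)) 𝓘(ℝ, ℂ) ∞ (a ∘ scaledPolar d) := by
    have h : ContMDiff ((𝓡 d).prod 𝓘(ℝ, Space d)) ((𝓡 d).prod 𝓘(ℝ, Space d)) ∞
        fun q : UnitSphere d × Space d => (q.1, (2 * Real.pi) • q.2) :=
      contMDiff_fst.prodMk ((contDiff_const_smul _).contMDiff.comp contMDiff_snd)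
    exact ha.smooth.comp (contMDiff_polar.comp h)
  have h2 := uniformSymbol_mul hf h1 (ha.compactSupport.comp_homeomorph _)
  convert h2 using 2 with h
  ext X ζ
  exact scaledSymbol_eq (hf.map_zero h.2) a X ζ

end SymbolBounds

/-! ### Decay and continuity of the inverse Fourier transform of a symbol. -/

section Kernel

variable {V : Type*} [NormedAddCommGroup V] [InnerProductSpace ℝ V]

/-- An integrable weight of polynomial decay. -/
def decay (z : V) : ℝ := ((1 + ‖z‖) ^ (Module.finrank ℝ V + 1))⁻¹

theorem decay_pos (z : V) : 0 < decay z := by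
  unfold decay
  positivity

theorem continuous_decay : Continuous (decay : V → ℝ) := by
  unfold decay
  exact Continuous.inv₀ (by fun_prop) fun z => by positivity

theorem norm_cexp_inner (x y : V) :
    ‖Complex.exp (2 * Real.pi * Complex.I * (⟪x, y⟫_ℝ : ℝ))‖ = 1 := by
  rw [show (2 * Real.pi * Complex.I * (⟪x, y⟫_ℝ : ℝ) : ℂ) =
    ((2 * Real.pi * ⟪x, y⟫_ℝ : ℝ) : ℂ) * Complex.I by push_cast; ring,
    Complex.norm_exp_ofReal_mul_I]

theorem UniformSymbol.exists_norm_le {ι : Type*} {s : ι → V → V → ℂ} (hs : UniformSymbol s) :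
    ∃ C, 0 ≤ C ∧ ∀ i X ζ, ‖s i X ζ‖ ≤ C := by
  obtain ⟨C, hC⟩ := hs.bound 0
  exact ⟨max C 0, le_max_right _ _, fun i X ζ => le_max_of_le_left (by simpa using hC i X ζ)⟩

variable [FiniteDimensional ℝ V] [MeasurableSpace V] [BorelSpace V]

theorem integrable_decay : Integrable (decay : V → ℝ) := by
  have h := integrable_one_add_norm (E := V) (μ := volume) (r := (Module.finrank ℝ V + 1 : ℕ))
    (by push_cast; linarith)
  refine h.congr (.of_forall fun z => ?_)
  simp only [decay]
  rw [Real.rpow_neg (by positivity), Real.rpow_natCast]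

theorem integrable_of_norm_le_of_support {E : Type*} [NormedAddCommGroup E] {g : V → E} {C R : ℝ}
    (hg : AEStronglyMeasurable g) (hC : ∀ ζ, ‖g ζ‖ ≤ C) (hR : ∀ ζ, R < ‖ζ‖ → g ζ = 0) :
    Integrable g ∧ ∫ ζ, ‖g ζ‖ ≤ C * (volume : Measure V).real (Metric.closedBall 0 R) := by
  have h1 : Integrable ((Metric.closedBall (0 : V) R).indicator fun _ => C) :=
    (integrable_indicator_iff Metric.isClosed_closedBall.measurableSet).2
      (integrableOn_const (by exact (isCompact_closedBall _ _).measure_lt_top.ne))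
  have h2 : ∀ ζ, ‖g ζ‖ ≤ (Metric.closedBall (0 : V) R).indicator (fun _ => C) ζ := by
    intro ζ
    by_cases hζ : ζ ∈ Metric.closedBall (0 : V) R
    · simpa [Set.indicator_of_mem hζ] using hC ζ
    · rw [Set.indicator_of_notMem hζ, hR ζ (by simpa using hζ), norm_zero]
  refine ⟨h1.mono' hg (.of_forall h2), (integral_mono_of_nonneg (.of_forall fun _ => norm_nonneg _)
    h1 (.of_forall h2)).trans ?_⟩
  rw [integral_indicator Metric.isClosed_closedBall.measurableSet, setIntegral_const, smul_eq_mul,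
    mul_comm]

/-- The inverse Fourier transform of a symbol in its second variable. -/
def symbolKernel (s : V → V → ℂ) (X z : V) : ℂ := FourierTransformInv.fourierInv (s X) z

theorem symbolKernel_eq (s : V → V → ℂ) (X z : V) :
    symbolKernel s X z = ∫ ζ, Complex.exp (2 * Real.pi * Complex.I * (⟪ζ, z⟫_ℝ : ℝ)) * s X ζ := by
  rw [symbolKernel, Real.fourierInv_eq']
  congr 1 with ζ
  rw [smul_eq_mul]
  congr 2
  push_cast
  ring

variable {ι : Type*} {s : ι → V → V → ℂ}

namespace UniformSymbol

theorem integrable (hs : UniformSymbol s) (i : ι) (X : V) : Integrable (s i X) := by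
  obtain ⟨R, hR⟩ := hs.support
  obtain ⟨C, -, hC⟩ := hs.exists_norm_le
  exact (integrable_of_norm_le_of_support (hs.smooth i X).continuous.aestronglyMeasurable
    (hC i X) (hR i X)).1

/-- Powers of `z` correspond to derivatives in `ζ`, whose `L¹` norms are bounded uniformly by the
common support and the derivative bounds. -/
theorem exists_pow_mul_norm_kernel_le (hs : UniformSymbol s) (n : ℕ) :
    ∃ C, 0 ≤ C ∧ ∀ i X z, ‖z‖ ^ n * ‖symbolKernel (s i) X z‖ ≤ C := by
  obtain ⟨R, hR⟩ := hs.support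
  choose C hC using hs.bound
  have hint : ∀ i X j, Integrable (iteratedFDeriv ℝ j (s i X)) ∧
      ∫ ζ, ‖iteratedFDeriv ℝ j (s i X) ζ‖ ≤
        C j * (volume : Measure V).real (Metric.closedBall 0 R) := by
    intro i X j
    refine integrable_of_norm_le_of_support ((hs.smooth i X).continuous_iteratedFDeriv
      (by exact_mod_cast le_top)).aestronglyMeasurable (hC j i X) fun ζ hζ => ?_
    have h1 : s i X =ᶠ[𝓝 ζ] 0 := by
      filter_upwards [continuous_norm.continuousAt.eventually (lt_mem_nhds hζ)] with ζ' h
      exact hR i X ζ' h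
    rw [(h1.iteratedFDeriv ℝ j).eq_of_nhds]
    simp
  refine ⟨max (2 ^ n * ∑ j ∈ Finset.range (n + 1),
    C j * (volume : Measure V).real (Metric.closedBall 0 R)) 0, le_max_right _ _,
    fun i X z => le_max_of_le_left ?_⟩
  have h := Real.pow_mul_norm_iteratedFDeriv_fourier_le (K := 0) (N := ⊤) (f := s i X)
    (hs.smooth i X) (k := 0) (n := n) (fun k m hk _ => by
      obtain rfl : k = 0 := by simpa using hk
      simpa using (hint i X m).1.norm) le_rfl le_top (-z)
  rw [norm_neg, norm_iteratedFDeriv_zero, ← Real.fourierInv_eq_fourier_neg] at h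
  refine h.trans ?_
  simp only [zero_add, Finset.range_one, Finset.singleton_product, Finset.sum_map, pow_zero,
    one_mul, Function.Embedding.coeFn_mk]
  norm_num
  gcongr with j _
  exact (hint i X j).2

theorem exists_norm_kernel_mul_pow_le (hs : UniformSymbol s) (n : ℕ) :
    ∃ C, 0 ≤ C ∧ ∀ i X z, ‖symbolKernel (s i) X z‖ * (1 + ‖z‖) ^ n ≤ C := by
  obtain ⟨C0, h0, hC0⟩ := hs.exists_pow_mul_norm_kernel_le 0
  obtain ⟨C, h, hC⟩ := hs.exists_pow_mul_norm_kernel_le n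
  refine ⟨2 ^ (n - 1) * (C0 + C), by positivity, fun i X z => ?_⟩
  have h1 := add_pow_le zero_le_one (norm_nonneg z) n
  have h2 := hC0 i X z
  have h3 := hC i X z
  calc _ ≤ ‖symbolKernel (s i) X z‖ * (2 ^ (n - 1) * (1 ^ n + ‖z‖ ^ n)) := by gcongr
    _ = 2 ^ (n - 1) * (‖z‖ ^ 0 * ‖symbolKernel (s i) X z‖ +
        ‖z‖ ^ n * ‖symbolKernel (s i) X z‖) := by rw [one_pow]; ring
    _ ≤ _ := by gcongr

theorem exists_norm_kernel_le (hs : UniformSymbol s) :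
    ∃ C, 0 ≤ C ∧ ∀ i X z, ‖symbolKernel (s i) X z‖ ≤ C * decay z := by
  obtain ⟨C, h, hC⟩ := hs.exists_norm_kernel_mul_pow_le (Module.finrank ℝ V + 1)
  refine ⟨C, h, fun i X z => ?_⟩
  rw [decay, ← div_eq_mul_inv, le_div_iff₀ (by positivity)]
  exact hC i X z

/-- The spare factor `1 + ‖z‖` later pays for the distance between `x` and `y` in the comparison of
kernels. -/
theorem exists_norm_mul_norm_kernel_le (hs : UniformSymbol s) :
    ∃ C, 0 ≤ C ∧ ∀ i X z, ‖symbolKernel (s i) X z‖ * (1 + ‖z‖) ≤ C * decay z := by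
  obtain ⟨C, h, hC⟩ := hs.exists_norm_kernel_mul_pow_le (Module.finrank ℝ V + 2)
  refine ⟨C, h, fun i X z => ?_⟩
  rw [decay, ← div_eq_mul_inv, le_div_iff₀ (by positivity), mul_assoc, ← pow_succ']
  exact hC i X z

theorem exists_norm_kernel_sub_le_const (hs : UniformSymbol s) {ε : ℝ} (hε : 0 < ε) :
    ∃ C, 0 ≤ C ∧ ∀ i X X' z,
      ‖symbolKernel (s i) X z - symbolKernel (s i) X' z‖ ≤ ε + C * ‖X - X'‖ := by
  obtain ⟨R, hR⟩ := hs.support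
  set v := (volume : Measure V).real (Metric.closedBall 0 R)
  have hv : 0 ≤ v := measureReal_nonneg
  obtain ⟨C, h0, hC⟩ := hs.modulus (ε / (v + 1)) (by positivity)
  refine ⟨C * v, by positivity, fun i X X' z => ?_⟩
  have h1 := (integrable_of_norm_le_of_support (g := fun ζ => s i X ζ - s i X' ζ)
    ((hs.smooth i X).continuous.sub (hs.smooth i X').continuous).aestronglyMeasurable
    (hC i X X') fun ζ hζ => by rw [hR i X ζ hζ, hR i X' ζ hζ, sub_zero])
  have hexp : Continuous fun ζ : V => Complex.exp (2 * Real.pi * Complex.I * (⟪ζ, z⟫_ℝ : ℝ)) := by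
    fun_prop
  have hi : ∀ X, Integrable fun ζ =>
      Complex.exp (2 * Real.pi * Complex.I * (⟪ζ, z⟫_ℝ : ℝ)) * s i X ζ := fun X =>
    (hs.integrable i X).bdd_mul hexp.aestronglyMeasurable
      (.of_forall fun ζ => (norm_cexp_inner ζ z).le)
  rw [symbolKernel_eq, symbolKernel_eq, ← integral_sub (hi X) (hi X')]
  calc _ ≤ ∫ ζ, ‖s i X ζ - s i X' ζ‖ := by
        refine norm_integral_le_of_norm_le h1.1.norm (.of_forall fun ζ => ?_)
        rw [← mul_sub, norm_mul, norm_cexp_inner, one_mul]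
    _ ≤ _ := h1.2
    _ = ε * (v / (v + 1)) + C * v * ‖X - X'‖ := by ring
    _ ≤ _ := by
      gcongr
      refine mul_le_of_le_one_right hε.le ((div_le_one (by positivity)).2 (by linarith))

/-- Interpolation: with `D` the difference and `w` the weight, `(D w)² = D · (D w²)`. The first
factor is small by continuity in `X`, and the second is bounded by the decay with exponent `2n`. -/
theorem exists_norm_kernel_sub_mul_pow_le (hs : UniformSymbol s) (n : ℕ) {ε : ℝ} (hε : 0 < ε) :
    ∃ C, 0 ≤ C ∧ ∀ i X X' z,
      ‖symbolKernel (s i) X z - symbolKernel (s i) X' z‖ * (1 + ‖z‖) ^ n ≤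
        ε + C * ‖X - X'‖ := by
  obtain ⟨B, hB0, hB⟩ := hs.exists_norm_kernel_mul_pow_le (2 * n)
  -- Multiplied by the bound `2 * B + 1` for `D w²`, this leaves exactly `ε ^ 2`.
  obtain ⟨C, hC0, hC⟩ := hs.exists_norm_kernel_sub_le_const (ε := ε ^ 2 / (2 * B + 1))
    (by positivity)
  refine ⟨C * (2 * B + 1) / ε, by positivity, fun i X X' z => ?_⟩
  set D := ‖symbolKernel (s i) X z - symbolKernel (s i) X' z‖
  set w := (1 + ‖z‖) ^ n with hw
  have hw0 : 0 < w := by positivity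
  have hD : 0 ≤ D := norm_nonneg _
  have h1 : D * w ^ 2 ≤ 2 * B := by
    have h2 := hB i X z
    have h3 := hB i X' z
    rw [mul_comm 2, pow_mul, ← hw] at h2 h3
    nlinarith [norm_sub_le (symbolKernel (s i) X z) (symbolKernel (s i) X' z), sq_nonneg w]
  have h2 := hC i X X' z
  have h3 : (D * w) ^ 2 ≤ ε ^ 2 + C * (2 * B + 1) * ‖X - X'‖ := by
    calc (D * w) ^ 2 = D * (D * w ^ 2) := by ring
      _ ≤ (ε ^ 2 / (2 * B + 1) + C * ‖X - X'‖) * (2 * B + 1) :=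
        mul_le_mul h2 (h1.trans (by linarith)) (by positivity) (by positivity)
      _ = _ := by field_simp
  have h5 : 0 ≤ C * (2 * B + 1) * ‖X - X'‖ := by positivity
  refine abs_le_of_sq_le_sq' (h3.trans ?_) (by positivity) |>.2
  have h6 : (ε + C * (2 * B + 1) / ε * ‖X - X'‖) ^ 2 = ε ^ 2 + 2 * (C * (2 * B + 1) * ‖X - X'‖) +
      (C * (2 * B + 1) / ε * ‖X - X'‖) ^ 2 := by
    field_simp
    ring
  rw [h6]
  nlinarith [sq_nonneg (C * (2 * B + 1) / ε * ‖X - X'‖)]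

theorem exists_norm_kernel_sub_le (hs : UniformSymbol s) {ε : ℝ} (hε : 0 < ε) :
    ∃ C, 0 ≤ C ∧ ∀ i X X' z,
      ‖symbolKernel (s i) X z - symbolKernel (s i) X' z‖ * (1 + ‖z‖) ≤
        (ε + C * ‖X - X'‖) * decay z := by
  obtain ⟨C, h, hC⟩ := hs.exists_norm_kernel_sub_mul_pow_le (Module.finrank ℝ V + 2) hε
  refine ⟨C, h, fun i X X' z => ?_⟩
  rw [decay, ← div_eq_mul_inv, le_div_iff₀ (by positivity), mul_assoc, ← pow_succ']
  exact hC i X X' z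

theorem continuous_kernel (hs : UniformSymbol s) (i : ι) :
    Continuous fun p : V × V => symbolKernel (s i) p.1 p.2 := by
  obtain ⟨R, hR⟩ := hs.support
  obtain ⟨C, -, hC⟩ := hs.exists_norm_le
  simp only [symbolKernel_eq]
  refine continuous_of_dominated (bound := (Metric.closedBall (0 : V) R).indicator fun _ => C)
    (fun p => ?_) (fun p => .of_forall fun ζ => ?_) ?_ (.of_forall fun ζ => ?_)
  · exact (Continuous.mul (by fun_prop) (hs.smooth i p.1).continuous).aestronglyMeasurable
  · rw [norm_mul, norm_cexp_inner, one_mul]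
    by_cases hζ : ζ ∈ Metric.closedBall (0 : V) R
    · simpa [Set.indicator_of_mem hζ] using hC i p.1 ζ
    · rw [Set.indicator_of_notMem hζ, hR i p.1 ζ (by simpa using hζ), norm_zero]
  · exact (integrable_indicator_iff Metric.isClosed_closedBall.measurableSet).2
      (integrableOn_const (isCompact_closedBall _ _).measure_lt_top.ne)
  · exact Continuous.mul (by fun_prop)
      ((hs.continuous i).comp (continuous_fst.prodMk continuous_const))

end UniformSymbol

end Kernel

/-! ### Schur's test on `L²`. -/

section Schur

/-- Cauchy–Schwarz for the splitting `φ F = φ^(1/2) · (φ^(1/2) F)`. -/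
theorem lintegral_mul_sq_le {α : Type*} [MeasurableSpace α] {μ : Measure α} {φ F : α → ℝ≥0∞}
    (hφ : AEMeasurable φ μ) (hF : AEMeasurable F μ) :
    (∫⁻ y, φ y * F y ∂μ) ^ 2 ≤ (∫⁻ y, φ y ∂μ) * ∫⁻ y, φ y * F y ^ 2 ∂μ := by
  have h := ENNReal.lintegral_mul_le_Lp_mul_Lq μ Real.HolderConjugate.two_two
    (hφ.pow_const (1 / 2 : ℝ)) ((hφ.pow_const (1 / 2 : ℝ)).mul hF)
  have h0 : ∀ t : ℝ≥0∞, t ^ (1 / 2 : ℝ) * t ^ (1 / 2 : ℝ) = t := fun t => by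
    rw [← ENNReal.rpow_add_of_nonneg _ _ (by norm_num) (by norm_num)]
    norm_num
  have h0' : ∀ t : ℝ≥0∞, (t ^ (1 / 2 : ℝ)) ^ 2 = t := fun t => by rw [sq, h0]
  simp only [Pi.mul_apply, ← mul_assoc, h0, ENNReal.rpow_two, mul_pow, h0'] at h
  calc _ ≤ ((∫⁻ y, φ y ∂μ) ^ (1 / 2 : ℝ) * (∫⁻ y, φ y * F y ^ 2 ∂μ) ^ (1 / 2 : ℝ)) ^ 2 := by gcongr
    _ = _ := by rw [mul_pow, h0', h0']

theorem eLpNorm_two_sq {α : Type*} [MeasurableSpace α] (μ : Measure α) (v : α → ℂ) :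
    eLpNorm v 2 μ ^ 2 = ∫⁻ x, ‖v x‖ₑ ^ 2 ∂μ := by
  simpa using eLpNorm_nnreal_pow_eq_lintegral (f := v) (μ := μ) (p := 2) (by norm_num)

variable {V : Type*} [NormedAddCommGroup V] [InnerProductSpace ℝ V]

theorem decay_le_one (z : V) : decay z ≤ 1 :=
  inv_le_one_of_one_le₀ (one_le_pow₀ (by linarith [norm_nonneg z]))

variable [FiniteDimensional ℝ V] [MeasurableSpace V] [BorelSpace V]

/-- Young's inequality for `L¹ * L²`: weighted Cauchy–Schwarz in `y`, then Tonelli and translation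
invariance. -/
theorem lintegral_convolution_sq_le {Φ F : V → ℝ≥0∞} (hΦ : Measurable Φ) (hF : AEMeasurable F) :
    ∫⁻ x, (∫⁻ y, Φ (x - y) * F y) ^ 2 ≤ (∫⁻ y, Φ y) ^ 2 * ∫⁻ y, F y ^ 2 := by
  calc ∫⁻ x, (∫⁻ y, Φ (x - y) * F y) ^ 2
      ≤ ∫⁻ x, (∫⁻ y, Φ y) * ∫⁻ y, Φ (x - y) * F y ^ 2 := by
        refine lintegral_mono fun x => ?_
        have hΦx : Measurable fun y => Φ (x - y) := hΦ.comp (measurable_const.sub measurable_id)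
        refine (lintegral_mul_sq_le hΦx.aemeasurable hF).trans_eq ?_
        rw [lintegral_sub_left_eq_self Φ x]
    _ = (∫⁻ y, Φ y) * ∫⁻ x, ∫⁻ y, Φ (x - y) * F y ^ 2 := by
        refine lintegral_const_mul'' _ ?_
        refine AEMeasurable.lintegral_prod_right'
          (f := fun p : V × V => Φ (p.1 - p.2) * F p.2 ^ 2) ?_
        exact (hΦ.comp (measurable_fst.sub measurable_snd)).aemeasurable.mul
          ((hF.comp_snd).pow_const _)
    _ = (∫⁻ y, Φ y) * ∫⁻ y, ∫⁻ x, Φ (x - y) * F y ^ 2 := by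
        rw [lintegral_lintegral_swap]
        exact (hΦ.comp (measurable_fst.sub measurable_snd)).aemeasurable.mul
          ((hF.comp_snd).pow_const _)
    _ = (∫⁻ y, Φ y) * ∫⁻ y, (∫⁻ x, Φ x) * F y ^ 2 := by
        congr 2 with y
        have hΦy : Measurable fun x => Φ (x - y) := hΦ.comp (measurable_id.sub measurable_const)
        rw [lintegral_mul_const _ hΦy, lintegral_sub_right_eq_self Φ y]
    _ = _ := by
        rw [lintegral_const_mul'' _ (hF.pow_const _), sq, mul_assoc]

theorem memLp_decay_sub (x : V) : MemLp (fun y => decay (x - y)) 2 (volume : Measure V) := by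
  have hc : Continuous fun y => decay (x - y) :=
    continuous_decay.comp (continuous_const.sub continuous_id)
  refine (memLp_two_iff_integrable_sq hc.aestronglyMeasurable).2 ?_
  refine (integrable_decay.comp_sub_left x).mono' (hc.pow 2).aestronglyMeasurable
    (.of_forall fun y => ?_)
  have h0 := (decay_pos (x - y)).le
  rw [Real.norm_of_nonneg (by positivity), sq]
  exact mul_le_of_le_one_left h0 (decay_le_one _)

variable {K : V → V → ℂ} {C : ℝ}

theorem integrable_kernel_mul (hK : StronglyMeasurable (Function.uncurry K))
    (hb : ∀ x y, ‖K x y‖ ≤ C * decay (x - y)) {u : V → ℂ} (hu : MemLp u 2) (x : V) :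
    Integrable fun y => K x y * u y := by
  have hKx : MemLp (fun y => K x y) 2 :=
    ((memLp_decay_sub x).const_mul C).mono' hK.of_uncurry_left.aestronglyMeasurable
      (.of_forall (hb x))
  exact hKx.integrable_mul hu

theorem memLp_kernel_integral (hC : 0 ≤ C) (hK : StronglyMeasurable (Function.uncurry K))
    (hb : ∀ x y, ‖K x y‖ ≤ C * decay (x - y)) {u : V → ℂ} (hu : MemLp u 2) :
    MemLp (fun x => ∫ y, K x y * u y) 2 ∧
      eLpNorm (fun x => ∫ y, K x y * u y) 2 volume ≤
        ENNReal.ofReal (C * ∫ z : V, decay z) * eLpNorm u 2 volume := by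
  have hm : AEStronglyMeasurable (fun x => ∫ y, K x y * u y) (volume : Measure V) :=
    AEStronglyMeasurable.integral_prod_right' (f := fun p : V × V => K p.1 p.2 * u p.2)
      (hK.aestronglyMeasurable.mul hu.1.comp_snd)
  have hΦ : Measurable fun z : V => ENNReal.ofReal (C * decay z) :=
    (continuous_decay.measurable.const_mul C).ennreal_ofReal
  have hint : ∫⁻ z : V, ENNReal.ofReal (C * decay z) = ENNReal.ofReal (C * ∫ z : V, decay z) := by
    rw [← integral_const_mul, ofReal_integral_eq_lintegral_ofReal (integrable_decay.const_mul C)]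
    exact .of_forall fun z => mul_nonneg hC (decay_pos z).le
  have hle : eLpNorm (fun x => ∫ y, K x y * u y) 2 volume ≤
      ENNReal.ofReal (C * ∫ z : V, decay z) * eLpNorm u 2 volume := by
    rw [← ENNReal.pow_le_pow_left_iff two_ne_zero, mul_pow, eLpNorm_two_sq, eLpNorm_two_sq, ← hint]
    refine le_trans (lintegral_mono fun x => ?_) (lintegral_convolution_sq_le hΦ hu.1.enorm)
    gcongr
    refine (enorm_integral_le_lintegral_enorm _).trans (lintegral_mono fun y => ?_)
    rw [enorm_mul]
    gcongr
    rw [← ofReal_norm]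
    exact ENNReal.ofReal_le_ofReal (hb x y)
  exact ⟨⟨hm, hle.trans_lt (ENNReal.mul_lt_top ENNReal.ofReal_lt_top hu.2)⟩, hle⟩

/-- **Schur test**: a kernel dominated by an integrable function of `x - y` is bounded on `L²`. -/
theorem exists_kernel_operator (hC : 0 ≤ C) (hK : StronglyMeasurable (Function.uncurry K))
    (hb : ∀ x y, ‖K x y‖ ≤ C * decay (x - y)) :
    ∃ T : Lp ℂ 2 (volume : Measure V) →L[ℂ] Lp ℂ 2 (volume : Measure V),
      ‖T‖ ≤ C * ∫ z : V, decay z ∧ ∀ u, T u =ᵐ[volume] fun x => ∫ y, K x y * u y := by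
  have hI : 0 ≤ C * ∫ z : V, decay z :=
    mul_nonneg hC (integral_nonneg fun z => (decay_pos z).le)
  have hmem := fun u : Lp ℂ 2 (volume : Measure V) => memLp_kernel_integral hC hK hb (Lp.memLp u)
  let T₀ : Lp ℂ 2 (volume : Measure V) →ₗ[ℂ] Lp ℂ 2 (volume : Measure V) :=
    { toFun := fun u => (hmem u).1.toLp _
      map_add' := fun u v => by
        rw [← MemLp.toLp_add]
        congr 1
        ext x
        rw [Pi.add_apply, ← integral_add (integrable_kernel_mul hK hb (Lp.memLp u) x)
          (integrable_kernel_mul hK hb (Lp.memLp v) x)]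
        refine integral_congr_ae ?_
        filter_upwards [Lp.coeFn_add u v] with y hy
        rw [hy, Pi.add_apply, mul_add]
      map_smul' := fun c u => by
        rw [RingHom.id_apply, ← MemLp.toLp_const_smul]
        congr 1
        ext x
        rw [Pi.smul_apply, smul_eq_mul, ← integral_const_mul]
        refine integral_congr_ae ?_
        filter_upwards [Lp.coeFn_smul c u] with y hy
        rw [hy, Pi.smul_apply, smul_eq_mul]
        ring }
  refine ⟨T₀.mkContinuous (C * ∫ z : V, decay z) fun u => ?_, T₀.mkContinuous_norm_le hI _,
    fun u => (hmem u).1.coeFn_toLp⟩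
  change ‖(hmem u).1.toLp _‖ ≤ _
  rw [Lp.norm_toLp, Lp.norm_def]
  refine (ENNReal.toReal_mono (ENNReal.mul_ne_top ENNReal.ofReal_ne_top (Lp.memLp u).2.ne)
    (hmem u).2).trans_eq ?_
  rw [ENNReal.toReal_mul, ENNReal.toReal_ofReal hI]

end Schur

/-! ### Integral kernels of Weyl operators and their boundedness. -/

section Weyl

/-- The integral kernel of the Weyl quantization `s^w(hx, D_x / 2π)`. -/
def weylKernel {V : Type*} [NormedAddCommGroup V] [InnerProductSpace ℝ V] [FiniteDimensional ℝ V]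
    [MeasurableSpace V] [BorelSpace V] (h : ℝ) (s : V → V → ℂ) (x y : V) : ℂ :=
  symbolKernel s ((h / 2) • (x + y)) (x - y)

variable {d : ℕ}

theorem continuous_weylKernel {ι : Type*} {s : ι → Space d → Space d → ℂ} (hs : UniformSymbol s)
    (h : ℝ) (i : ι) : Continuous (Function.uncurry (weylKernel h (s i))) :=
  (hs.continuous_kernel i).comp (f := fun p : Space d × Space d =>
    ((h / 2) • (p.1 + p.2), p.1 - p.2)) (by fun_prop)

/-- The substitution `ξ = 2πζ` absorbs the prefactor `(2π)⁻ⁿ` and turns the frequency integral into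
the normalized inverse Fourier transform. Fubini applies since `u` is integrable and the symbol is
bounded with compact frequency support. -/
theorem weylIntegral_eq {σ : Space d → Space d → ℂ}
    (hs : UniformSymbol fun (_ : Unit) X ζ => σ X ((2 * Real.pi) • ζ)) (h : ℝ) {u : Space d → ℂ}
    (hu : Integrable u) (x : Space d) :
    weylIntegral h σ u x =
      ∫ y, weylKernel h (fun X ζ => σ X ((2 * Real.pi) • ζ)) x y * u y := by
  have hπ : (2 * Real.pi) ≠ 0 := by positivity
  obtain ⟨R, hR⟩ := hs.support
  obtain ⟨B, hB0, hB⟩ := hs.exists_norm_le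
  have hσ : ∀ X ξ, σ X ξ = σ X ((2 * Real.pi) • (2 * Real.pi)⁻¹ • ξ) := fun X ξ => by
    rw [smul_inv_smul₀ hπ]
  have hσR : ∀ X ξ, 2 * Real.pi * R < ‖ξ‖ → σ X ξ = 0 := fun X ξ hξ => by
    rw [hσ]
    refine hR () X _ ?_
    rw [norm_smul, norm_inv, Real.norm_of_nonneg (by positivity), ← div_eq_inv_mul,
      lt_div_iff₀ (by positivity)]
    linarith
  have hσB : ∀ X ξ, ‖σ X ξ‖ ≤ B := fun X ξ => by
    rw [hσ]
    exact hB () X _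
  have hσc : Continuous fun p : Space d × Space d => σ p.1 p.2 := by
    have h1 : Continuous fun p : Space d × Space d =>
        σ p.1 ((2 * Real.pi) • (2 * Real.pi)⁻¹ • p.2) :=
      (hs.continuous ()).comp (f := fun p : Space d × Space d => (p.1, (2 * Real.pi)⁻¹ • p.2))
        (by fun_prop)
    simpa only [← hσ] using h1
  have hint : Integrable (fun p : Space d × Space d =>
      Complex.exp (Complex.I * (⟪x - p.1, p.2⟫_ℝ : ℝ)) * σ ((h / 2) • (x + p.1)) p.2 * u p.1)
      (volume.prod volume) := by
    have h1 : Integrable (fun p : Space d × Space d =>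
        ‖u p.1‖ * (Metric.closedBall (0 : Space d) (2 * Real.pi * R)).indicator (fun _ => B) p.2)
        (volume.prod volume) :=
      hu.norm.mul_prod ((integrable_indicator_iff Metric.isClosed_closedBall.measurableSet).2
        (integrableOn_const (isCompact_closedBall _ _).measure_lt_top.ne))
    refine h1.mono' (AEStronglyMeasurable.mul ?_ hu.1.comp_fst) (.of_forall fun p => ?_)
    · refine Continuous.aestronglyMeasurable (Continuous.mul (by fun_prop) ?_)
      exact hσc.comp (f := fun p : Space d × Space d => ((h / 2) • (x + p.1), p.2)) (by fun_prop)
    · rw [norm_mul, norm_mul, mul_comm Complex.I, Complex.norm_exp_ofReal_mul_I, one_mul,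
        mul_comm]
      gcongr
      by_cases hξ : p.2 ∈ Metric.closedBall (0 : Space d) (2 * Real.pi * R)
      · rw [Set.indicator_of_mem hξ]
        exact hσB _ _
      · rw [Set.indicator_of_notMem hξ, hσR _ _ (by simpa using hξ), norm_zero]
  rw [weylIntegral, Measure.volume_eq_prod, integral_prod _ hint, ← integral_const_mul]
  congr 1 with y
  dsimp only
  rw [integral_mul_const, ← mul_assoc]
  congr 1
  rw [weylKernel, symbolKernel_eq]
  have h2 := Measure.integral_comp_smul (volume : Measure (Space d)) (fun ξ =>
    Complex.exp (Complex.I * (⟪x - y, ξ⟫_ℝ : ℝ)) * σ ((h / 2) • (x + y)) ξ) (2 * Real.pi)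
  have h3 : |((2 * Real.pi) ^ Module.finrank ℝ (Space d))⁻¹| = (2 * Real.pi)⁻¹ ^ (d + 1) := by
    rw [abs_of_nonneg (by positivity), finrank_euclideanSpace_fin, inv_pow]
  rw [h3, Complex.real_smul] at h2
  rw [show ((2 * Real.pi : ℝ) : ℂ)⁻¹ ^ (d + 1) = (((2 * Real.pi)⁻¹ ^ (d + 1) : ℝ) : ℂ) by
      push_cast; rfl,
    ← h2]
  congr 1 with ζ
  rw [inner_smul_right, real_inner_comm]
  congr 2
  push_cast
  ring

/-- Schur's test produces one bounded extension, and uniqueness identifies it with the chosen `Op`.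
The constant is uniform in `h` because the kernel bounds are. -/
theorem exists_isWeylQuantization {f : ℝ → ℝ → ℂ} (hf : IsAdmissibleCutoff f) {a : Phase d → ℂ}
    (ha : IsTestFunction a) :
    ∃ C, 0 ≤ C ∧ ∀ h ∈ Set.Ioo (0 : ℝ) 1, IsWeylQuantization h (symbol (f h) a) (Op (f h) h a) ∧
      ‖Op (f h) h a‖ ≤ C ∧ ∀ u, Op (f h) h a u =ᵐ[volume] fun x =>
        ∫ y, weylKernel h (scaledSymbol (f h) a) x y * u y := by
  have hs := uniformSymbol_scaledSymbol hf ha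
  obtain ⟨C, hC0, hC⟩ := hs.exists_norm_kernel_le
  refine ⟨C * ∫ z : Space d, decay z, mul_nonneg hC0 (integral_nonneg fun z => (decay_pos z).le),
    fun h hh => ?_⟩
  obtain ⟨T, hT, hTK⟩ := exists_kernel_operator hC0
    (continuous_weylKernel hs h ⟨h, hh⟩).stronglyMeasurable
    fun x y => hC ⟨h, hh⟩ ((h / 2) • (x + y)) (x - y)
  have hs' : UniformSymbol fun (_ : Unit) => scaledSymbol (f h) a :=
    ⟨fun _ => hs.continuous ⟨h, hh⟩, fun _ => hs.smooth ⟨h, hh⟩,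
      hs.support.imp fun _ H _ => H ⟨h, hh⟩, fun j => (hs.bound j).imp fun _ H _ => H ⟨h, hh⟩,
      fun ε hε => (hs.modulus ε hε).imp fun _ H => ⟨H.1, fun _ => H.2 ⟨h, hh⟩⟩⟩
  have hW : IsWeylQuantization h (symbol (f h) a) T := by
    intro u
    filter_upwards [hTK (u.toLp 2)] with x hx
    rw [hx, weylIntegral_eq hs' h u.integrable x]
    refine integral_congr_ae ?_
    filter_upwards [u.coeFn_toLp 2 volume] with y hy
    rw [hy]
    rfl
  have hOp : IsWeylQuantization h (symbol (f h) a) (Op (f h) h a) := by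
    have H : ∃ T, IsWeylQuantization h (symbol (f h) a) T := ⟨T, hW⟩
    rw [Op, dif_pos H]
    exact H.choose_spec
  rw [hOp.unique hW]
  exact ⟨hW, hT, hTK⟩

end Weyl

/-! ### Integrating a symbol against `|ŵ|²`. -/

section FourierSquare

variable {V : Type*} [NormedAddCommGroup V] [InnerProductSpace ℝ V] [FiniteDimensional ℝ V]
  [MeasurableSpace V] [BorelSpace V]

theorem fourier_eq_integral (w : V → ℂ) (ζ : V) :
    FourierTransform.fourier w ζ =
      ∫ y, Complex.exp (-(2 * Real.pi * Complex.I * (⟪ζ, y⟫_ℝ : ℝ))) * w y := by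
  rw [Real.fourier_eq']
  congr 1 with y
  rw [smul_eq_mul, real_inner_comm]
  congr 2
  push_cast
  ring

theorem ofReal_norm_sq_fourier (w : V → ℂ) (ζ : V) :
    ((‖FourierTransform.fourier w ζ‖ ^ 2 : ℝ) : ℂ) =
      ∫ p : V × V, Complex.exp (2 * Real.pi * Complex.I * (⟪ζ, p.1 - p.2⟫_ℝ : ℝ)) *
        (starRingEnd ℂ (w p.1) * w p.2) := by
  have h1 : starRingEnd ℂ (FourierTransform.fourier w ζ) =
      ∫ x, Complex.exp (2 * Real.pi * Complex.I * (⟪ζ, x⟫_ℝ : ℝ)) * starRingEnd ℂ (w x) := by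
    rw [fourier_eq_integral, ← integral_conj]
    congr 1 with x
    rw [map_mul, ← Complex.exp_conj]
    simp [map_ofNat]
  have h2 : ((‖FourierTransform.fourier w ζ‖ ^ 2 : ℝ) : ℂ) =
      starRingEnd ℂ (FourierTransform.fourier w ζ) * FourierTransform.fourier w ζ := by
    rw [Complex.conj_mul']
    push_cast
    rfl
  rw [h2, h1, fourier_eq_integral, Measure.volume_eq_prod, ← integral_prod_mul]
  congr 1 with p
  rw [inner_sub_right, show (2 * Real.pi * Complex.I * ((⟪ζ, p.1⟫_ℝ - ⟪ζ, p.2⟫_ℝ : ℝ) : ℂ)) =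
    2 * Real.pi * Complex.I * (⟪ζ, p.1⟫_ℝ : ℝ) + -(2 * Real.pi * Complex.I * (⟪ζ, p.2⟫_ℝ : ℝ)) by
      push_cast; ring, Complex.exp_add]
  ring

/-- Expand `|ŵ|²` as a double integral and do the `ζ` integral before it: the phase depends only on
the difference of the two positions. -/
theorem integral_mul_norm_sq_fourier {s w : V → ℂ} (hs : Integrable s) (hw : Integrable w) :
    ∫ ζ, s ζ * ((‖FourierTransform.fourier w ζ‖ ^ 2 : ℝ) : ℂ) =
      ∫ p : V × V, starRingEnd ℂ (w p.1) * w p.2 *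
        FourierTransformInv.fourierInv s (p.1 - p.2) := by
  have hww : Integrable (fun p : V × V => starRingEnd ℂ (w p.1) * w p.2)
      (volume : Measure (V × V)) :=
    (LinearIsometryEquiv.integrable_comp_iff Complex.conjLIE |>.2 hw).mul_prod hw
  have hint : Integrable (Function.uncurry fun (ζ : V) (p : V × V) =>
      s ζ * (Complex.exp (2 * Real.pi * Complex.I * (⟪ζ, p.1 - p.2⟫_ℝ : ℝ)) *
        (starRingEnd ℂ (w p.1) * w p.2))) ((volume : Measure V).prod volume) := by
    have h1 := (hs.mul_prod hww).bdd_mul (c := 1) (f := fun q : V × V × V =>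
      Complex.exp (2 * Real.pi * Complex.I * (⟪q.1, q.2.1 - q.2.2⟫_ℝ : ℝ)))
      (Continuous.aestronglyMeasurable (by fun_prop))
      (.of_forall fun q => (norm_cexp_inner _ _).le)
    refine h1.congr (.of_forall fun q => ?_)
    simp only [Function.uncurry]
    ring
  simp only [ofReal_norm_sq_fourier, ← integral_const_mul]
  rw [integral_integral_swap hint]
  congr 1 with p
  rw [Real.fourierInv_eq', ← integral_const_mul]
  congr 1 with ζ
  rw [smul_eq_mul, show ((2 * Real.pi * ⟪ζ, p.1 - p.2⟫_ℝ : ℝ) : ℂ) * Complex.I =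
    2 * Real.pi * Complex.I * (⟪ζ, p.1 - p.2⟫_ℝ : ℝ) by push_cast; ring]
  ring

end FourierSquare

/-! ### The short-time Fourier transform and its phase space density. -/

section Packet

variable {V : Type*} [NormedAddCommGroup V] [InnerProductSpace ℝ V]

/-- The localization of `u` to the region where `δ y` is close to `Y`. -/
def packet (g : V → ℝ) (δ : ℝ) (u : V → ℂ) (Y y : V) : ℂ := g (δ • y - Y) * u y

theorem norm_packet_le {g : V → ℝ} {δ M : ℝ} (hM : ∀ t, ‖g t‖ ≤ M) (u : V → ℂ) (Y y : V) :
    ‖packet g δ u Y y‖ ≤ M * ‖u y‖ := by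
  rw [packet, norm_mul, Complex.norm_real]
  gcongr
  exact hM _

variable [FiniteDimensional ℝ V] [MeasurableSpace V] [BorelSpace V]

/-- A smooth window supported in the unit ball and normalized in `L²`. -/
structure IsWindow (g : V → ℝ) : Prop where
  smooth : ContDiff ℝ ∞ g
  support : ∀ t, 1 < ‖t‖ → g t = 0
  integral_sq : ∫ t, g t ^ 2 = 1

theorem exists_isWindow (V : Type*) [NormedAddCommGroup V] [InnerProductSpace ℝ V]
    [FiniteDimensional ℝ V] [MeasurableSpace V] [BorelSpace V] : ∃ g : V → ℝ, IsWindow g := by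
  let φ : ContDiffBump (0 : V) := ⟨1 / 2, 1, by norm_num, by norm_num⟩
  have hI : 0 < ∫ t, φ t ^ 2 := by
    refine (integral_pos_iff_support_of_nonneg (fun t => sq_nonneg _) ?_).2 ?_
    · simp only [sq]
      exact (φ.continuous.mul φ.continuous).integrable_of_hasCompactSupport
        φ.hasCompactSupport.mul_left
    · refine (Metric.isOpen_ball (x := (0 : V)) (ε := 1)).measure_pos volume ⟨0, by simp⟩
        |>.trans_le (measure_mono fun t ht => ?_)
      have : φ t ≠ 0 := (φ.pos_of_mem_ball ht).ne'
      simpa using this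
  refine ⟨fun t => (√(∫ t, φ t ^ 2))⁻¹ * φ t, contDiff_const.mul φ.contDiff, fun t ht => ?_, ?_⟩
  · rw [φ.zero_of_le_dist (by simpa using ht.le), mul_zero]
  · simp only [mul_pow, inv_pow, Real.sq_sqrt hI.le]
    rw [integral_const_mul, inv_mul_cancel₀ hI.ne']

namespace IsWindow

variable {g : V → ℝ}

theorem hasCompactSupport (hg : IsWindow g) : HasCompactSupport g :=
  HasCompactSupport.intro (isCompact_closedBall (0 : V) 1) fun t ht =>
    hg.support t (by simpa using ht)

theorem integrable (hg : IsWindow g) : Integrable g :=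
  hg.smooth.continuous.integrable_of_hasCompactSupport hg.hasCompactSupport

theorem integrable_sq (hg : IsWindow g) : Integrable fun t => g t ^ 2 := by
  simp only [sq]
  exact (hg.smooth.continuous.mul hg.smooth.continuous).integrable_of_hasCompactSupport
    hg.hasCompactSupport.mul_left

theorem exists_norm_le (hg : IsWindow g) : ∃ M, 0 ≤ M ∧ ∀ t, ‖g t‖ ≤ M := by
  obtain ⟨M, hM⟩ := hg.hasCompactSupport.exists_bound_of_continuous hg.smooth.continuous
  exact ⟨M, (norm_nonneg _).trans (hM 0), hM⟩

theorem exists_lipschitz (hg : IsWindow g) : ∃ L, 0 ≤ L ∧ ∀ t t', ‖g t - g t'‖ ≤ L * ‖t - t'‖ := by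
  obtain ⟨L, hL⟩ := hg.smooth.lipschitzWith_of_hasCompactSupport hg.hasCompactSupport (by simp)
  exact ⟨L, L.2, fun t t' => hL.norm_sub_le t t'⟩

end IsWindow

/-- The short-time Fourier transform of `u` with the window `g (δ ·)`. -/
def packetTransform (g : V → ℝ) (δ : ℝ) (u : V → ℂ) (p : V × V) : ℂ :=
  FourierTransform.fourier (packet g δ u p.1) p.2

/-- The phase space density of `u`. -/
def packetMeasure (g : V → ℝ) (δ : ℝ) (u : V → ℂ) : Measure (V × V) :=
  (volume : Measure (V × V)).withDensity fun p => ‖packetTransform g δ u p‖ₑ ^ 2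

variable {g : V → ℝ} {δ : ℝ}

theorem continuous_packet (hg : IsWindow g) (u : 𝓢(V, ℂ)) (Y : V) :
    Continuous (packet g δ u Y) := by
  have := hg.smooth.continuous
  have := u.continuous
  unfold packet
  fun_prop

theorem integrable_packet (hg : IsWindow g) (u : 𝓢(V, ℂ)) (Y : V) :
    Integrable (packet g δ u Y) := by
  obtain ⟨M, hM0, hM⟩ := hg.exists_norm_le
  exact (u.integrable.norm.const_mul M).mono' (continuous_packet hg u Y).aestronglyMeasurable
    (.of_forall fun y => norm_packet_le hM u Y y)

theorem continuous_packetTransform (hg : IsWindow g) (u : 𝓢(V, ℂ)) :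
    Continuous (packetTransform g δ u) := by
  obtain ⟨M, hM0, hM⟩ := hg.exists_norm_le
  have hgc := hg.smooth.continuous
  have huc := u.continuous
  unfold packetTransform
  simp only [fourier_eq_integral]
  refine continuous_of_dominated (bound := fun y => M * ‖u y‖) (fun p => ?_)
    (fun p => .of_forall fun y => ?_) (u.integrable.norm.const_mul M) (.of_forall fun y => ?_)
  · exact (Continuous.mul (by fun_prop) (continuous_packet hg u p.1)).aestronglyMeasurable
  · rw [norm_mul, Complex.exp_neg, norm_inv, norm_cexp_inner, inv_one, one_mul]
    exact norm_packet_le hM u _ y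
  · unfold packet
    fun_prop

/-- For `δ ≠ 0` the packet is smooth with compact support, hence Schwartz, and Plancherel applies.
-/
theorem lintegral_packetTransform_fiber (hg : IsWindow g) (hδ : δ ≠ 0) (u : 𝓢(V, ℂ)) (Y : V) :
    ∫⁻ ζ, ‖packetTransform g δ u (Y, ζ)‖ₑ ^ 2 = ∫⁻ y, ‖packet g δ u Y y‖ₑ ^ 2 := by
  have hsm : ContDiff ℝ ∞ (packet g δ u Y) := by
    have h1 : ContDiff ℝ ∞ fun y => g (δ • y - Y) :=
      hg.smooth.comp ((contDiff_const_smul δ).sub contDiff_const)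
    exact (Complex.ofRealCLM.contDiff.comp h1).mul (u.smooth ⊤)
  have hcs : HasCompactSupport (packet g δ u Y) := by
    have h1 : HasCompactSupport fun y => g (δ • y - Y) :=
      hg.hasCompactSupport.comp_homeomorph
        ((Homeomorph.smulOfNeZero δ hδ).trans (Homeomorph.subRight Y))
    exact (h1.comp_left (g := ((↑) : ℝ → ℂ)) Complex.ofReal_zero).mul_right
  set W := hcs.toSchwartzMap hsm with hW
  have hpl := W.integral_norm_sq_fourier
  have hF : ∀ ζ, FourierTransform.fourier W ζ = packetTransform g δ u (Y, ζ) := fun ζ => rfl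
  have h2 : ∀ w : 𝓢(V, ℂ), ∫⁻ y, ‖w y‖ₑ ^ 2 = ENNReal.ofReal (∫ y, ‖w y‖ ^ 2) := fun w => by
    rw [ofReal_integral_eq_lintegral_ofReal (μ := volume) (f := fun y => ‖w y‖ ^ 2)
      ((memLp_two_iff_integrable_sq_norm w.continuous.aestronglyMeasurable).1 (w.memLp 2))
      (.of_forall fun y => by positivity)]
    congr 1 with y
    rw [← ofReal_norm, ENNReal.ofReal_pow (norm_nonneg _)]
  have h3 := h2 (FourierTransform.fourier W)
  rw [hpl, ← h2 W] at h3
  exact h3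

theorem lintegral_window_sq (hg : IsWindow g) (x : V) :
    ∫⁻ Y, ‖((g (x - Y) : ℝ) : ℂ)‖ₑ ^ 2 = 1 := by
  have h1 : ∀ Y, ‖((g (x - Y) : ℝ) : ℂ)‖ₑ ^ 2 = (fun t => ENNReal.ofReal (g t ^ 2)) (x - Y) := by
    intro Y
    rw [← ofReal_norm, Complex.norm_real, ← ENNReal.ofReal_pow (norm_nonneg _), Real.norm_eq_abs,
      sq_abs]
  simp only [h1]
  rw [lintegral_sub_left_eq_self (fun t => ENNReal.ofReal (g t ^ 2)) x,
    ← ofReal_integral_eq_lintegral_ofReal hg.integrable_sq (.of_forall fun t => sq_nonneg _),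
    hg.integral_sq, ENNReal.ofReal_one]

/-- Plancherel removes the frequency, and `∫ g² = 1` then removes `Y`. This mass bound is the source
of compactness. -/
theorem packetMeasure_univ (hg : IsWindow g) (hδ : δ ≠ 0) (u : 𝓢(V, ℂ)) :
    packetMeasure g δ u Set.univ = ∫⁻ y, ‖u y‖ₑ ^ 2 := by
  have hm := (continuous_packetTransform (δ := δ) hg u).measurable.enorm.pow_const 2
  have hc : Continuous (Function.uncurry (packet g δ u)) := by
    have hgc := hg.smooth.continuous
    have huc := u.continuous
    unfold packet Function.uncurry
    fun_prop
  rw [packetMeasure, withDensity_apply _ MeasurableSet.univ, Measure.restrict_univ,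
    Measure.volume_eq_prod, lintegral_prod _ hm.aemeasurable]
  simp only [lintegral_packetTransform_fiber hg hδ]
  rw [lintegral_lintegral_swap (hc.measurable.enorm.pow_const 2).aemeasurable]
  congr 1 with y
  simp only [packet, enorm_mul, mul_pow]
  rw [lintegral_mul_const', lintegral_window_sq hg, one_mul]
  simp

end Packet

/-! ### Comparison of the Weyl and anti-Wick quantizations. -/

section AntiWick

variable {V : Type*} [NormedAddCommGroup V] [InnerProductSpace ℝ V] [FiniteDimensional ℝ V]
  [MeasurableSpace V] [BorelSpace V]

/-- The integral kernel of the quadratic form that integrates a symbol against `packetMeasure`. -/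
def antiWickKernel (g : V → ℝ) (δ : ℝ) (s : V → V → ℂ) (x y : V) : ℂ :=
  ∫ Y, ((g (δ • x - Y) * g (δ • y - Y) : ℝ) : ℂ) * symbolKernel s (δ • Y) (x - y)

variable {g : V → ℝ} {ι : Type*} {s : ι → V → V → ℂ}

theorem continuous_antiWick_integrand (hg : IsWindow g) (hs : UniformSymbol s) (δ : ℝ) (i : ι) :
    Continuous fun q : (V × V) × V => ((g (δ • q.1.1 - q.2) * g (δ • q.1.2 - q.2) : ℝ) : ℂ) *
      symbolKernel (s i) (δ • q.2) (q.1.1 - q.1.2) := by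
  have h1 := hg.smooth.continuous
  have h2 : Continuous fun q : (V × V) × V => symbolKernel (s i) (δ • q.2) (q.1.1 - q.1.2) :=
    (hs.continuous_kernel i).comp (f := fun q : (V × V) × V => (δ • q.2, q.1.1 - q.1.2))
      (by fun_prop)
  fun_prop

theorem stronglyMeasurable_antiWickKernel (hg : IsWindow g) (hs : UniformSymbol s) (δ : ℝ)
    (i : ι) : StronglyMeasurable (Function.uncurry (antiWickKernel g δ (s i))) :=
  (continuous_antiWick_integrand hg hs δ i).stronglyMeasurable.integral_prod_right

/-- Since `∫ g(δx - Y)² dY = 1`, the Weyl kernel is an average over `Y` of itself. Two replacements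
lead to the anti-Wick kernel: the midpoint `X` by `δ Y`, at distance at most `δ (1 + ‖z‖)` on the
support of the window, and one factor `g(δx - Y)` by `g(δy - Y)`, at cost `L δ ‖z‖`. The spare decay
of the kernel absorbs both factors in `z`. -/
theorem exists_norm_weylKernel_sub_antiWickKernel_le (hg : IsWindow g) (hs : UniformSymbol s)
    {ε : ℝ} (hε : 0 < ε) :
    ∃ C, 0 ≤ C ∧ ∀ i, ∀ δ ∈ Set.Ioo (0 : ℝ) 1, ∀ x y,
      ‖weylKernel (δ ^ 2) (s i) x y - antiWickKernel g δ (s i) x y‖ ≤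
        (ε + C * δ) * decay (x - y) := by
  obtain ⟨C₁, hC₁0, hC₁⟩ := hs.exists_norm_kernel_sub_le hε
  obtain ⟨C₂, hC₂0, hC₂⟩ := hs.exists_norm_mul_norm_kernel_le
  obtain ⟨L, hL0, hL⟩ := hg.exists_lipschitz
  refine ⟨C₁ + L * C₂ * ∫ t, ‖g t‖, by positivity, fun i δ hδ x y => ?_⟩
  obtain ⟨hδ0, hδ1⟩ := hδ
  set z := x - y with hz
  set k := symbolKernel (s i) with hk
  set X := (δ ^ 2 / 2) • (x + y) with hX
  have hgc := hg.smooth.continuous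
  have hkc : Continuous fun Y => k (δ • Y) z :=
    (hs.continuous_kernel i).comp (f := fun Y : V => (δ • Y, z)) (by fun_prop)
  have hd := (decay_pos z).le
  have hz0 := norm_nonneg z
  have hb1 : ∀ Y, ‖((g (δ • x - Y) ^ 2 : ℝ) : ℂ) * (k X z - k (δ • Y) z)‖ ≤
      g (δ • x - Y) ^ 2 * ((ε + C₁ * δ) * decay z) := by
    intro Y
    rw [norm_mul, Complex.norm_real, Real.norm_of_nonneg (sq_nonneg _)]
    rcases lt_or_ge 1 ‖δ • x - Y‖ with h | h
    · simp [hg.support _ h]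
    gcongr
    have h1 : X - δ • Y = δ • (δ • x - Y) - (δ ^ 2 / 2) • z := by
      rw [hX, hz]
      module
    have h2 : ‖X - δ • Y‖ ≤ δ * (1 + ‖z‖) := by
      rw [h1]
      refine (norm_sub_le _ _).trans ?_
      rw [norm_smul, norm_smul, Real.norm_of_nonneg hδ0.le, Real.norm_of_nonneg (by positivity)]
      nlinarith [mul_le_mul_of_nonneg_left h hδ0.le,
        mul_nonneg (mul_nonneg hδ0.le (sub_nonneg.2 hδ1.le)) hz0, mul_nonneg hδ0.le hz0]
    have h3 := hC₁ i X (δ • Y) z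
    have h4 : ‖k X z - k (δ • Y) z‖ * (1 + ‖z‖) ≤ ((ε + C₁ * δ) * decay z) * (1 + ‖z‖) := by
      refine h3.trans ?_
      have h5 : ε + C₁ * ‖X - δ • Y‖ ≤ (ε + C₁ * δ) * (1 + ‖z‖) := by
        nlinarith [mul_le_mul_of_nonneg_left h2 hC₁0]
      calc _ ≤ ((ε + C₁ * δ) * (1 + ‖z‖)) * decay z := by gcongr
        _ = _ := by ring
    exact le_of_mul_le_mul_right h4 (by positivity)
  have hb2 : ∀ Y, ‖((g (δ • x - Y) * (g (δ • x - Y) - g (δ • y - Y)) : ℝ) : ℂ) * k (δ • Y) z‖ ≤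
      ‖g (δ • x - Y)‖ * (L * C₂ * δ * decay z) := by
    intro Y
    rw [norm_mul, Complex.norm_real, norm_mul, mul_assoc]
    refine mul_le_mul_of_nonneg_left ?_ (norm_nonneg _)
    have h1 : ‖g (δ • x - Y) - g (δ • y - Y)‖ ≤ L * (δ * ‖z‖) := by
      refine (hL _ _).trans_eq ?_
      rw [sub_sub_sub_cancel_right, ← smul_sub, norm_smul, Real.norm_of_nonneg hδ0.le]
    have h2 : ‖k (δ • Y) z‖ * (1 + ‖z‖) ≤ C₂ * decay z := hC₂ i (δ • Y) z
    calc _ ≤ L * (δ * ‖z‖) * ‖k (δ • Y) z‖ := by gcongr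
      _ = L * δ * (‖k (δ • Y) z‖ * ‖z‖) := by ring
      _ ≤ L * δ * (‖k (δ • Y) z‖ * (1 + ‖z‖)) := by gcongr; linarith
      _ ≤ L * δ * (C₂ * decay z) := by gcongr
      _ = _ := by ring
  have hi1 := (hg.integrable_sq.comp_sub_left (δ • x)).mul_const ((ε + C₁ * δ) * decay z)
  have hi2 := (hg.integrable.norm.comp_sub_left (δ • x)).mul_const (L * C₂ * δ * decay z)
  have hI1 : Integrable fun Y => ((g (δ • x - Y) ^ 2 : ℝ) : ℂ) * (k X z - k (δ • Y) z) :=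
    hi1.mono' (Continuous.mul (by fun_prop) (continuous_const.sub hkc)).aestronglyMeasurable
      (.of_forall hb1)
  have hI2 : Integrable fun Y =>
      ((g (δ • x - Y) * (g (δ • x - Y) - g (δ • y - Y)) : ℝ) : ℂ) * k (δ • Y) z :=
    hi2.mono' (Continuous.mul (by fun_prop) hkc).aestronglyMeasurable (.of_forall hb2)
  have hI3 : Integrable fun Y => ((g (δ • x - Y) ^ 2 : ℝ) : ℂ) * k X z :=
    ((hg.integrable_sq.comp_sub_left (δ • x)).ofReal).mul_const _
  have hone : ∫ Y, ((g (δ • x - Y) ^ 2 : ℝ) : ℂ) = 1 := by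
    rw [integral_complex_ofReal, integral_sub_left_eq_self (fun t => g t ^ 2) volume (δ • x),
      hg.integral_sq, Complex.ofReal_one]
  have hsplit : weylKernel (δ ^ 2) (s i) x y - antiWickKernel g δ (s i) x y =
      (∫ Y, ((g (δ • x - Y) ^ 2 : ℝ) : ℂ) * (k X z - k (δ • Y) z)) +
        ∫ Y, ((g (δ • x - Y) * (g (δ • x - Y) - g (δ • y - Y)) : ℝ) : ℂ) * k (δ • Y) z := by
    have h1 : weylKernel (δ ^ 2) (s i) x y = ∫ Y, ((g (δ • x - Y) ^ 2 : ℝ) : ℂ) * k X z := by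
      rw [integral_mul_const, hone, one_mul]
      rfl
    rw [h1, ← integral_add hI1 hI2, antiWickKernel, eq_comm, eq_sub_iff_add_eq]
    have hI4 : Integrable fun Y =>
        ((g (δ • x - Y) * g (δ • y - Y) : ℝ) : ℂ) * symbolKernel (s i) (δ • Y) (x - y) := by
      refine ((hI3.sub hI1).sub hI2).congr (.of_forall fun Y => ?_)
      simp only [Pi.sub_apply]
      push_cast
      ring
    refine (integral_add (hI1.add hI2) hI4).symm.trans ?_
    congr 1 with Y
    simp only [Pi.add_apply]
    push_cast
    ring
  rw [hsplit]
  refine (norm_add_le _ _).trans ?_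
  have e1 := norm_integral_le_of_norm_le hi1 (.of_forall hb1)
  have e2 := norm_integral_le_of_norm_le hi2 (.of_forall hb2)
  rw [integral_mul_const, integral_sub_left_eq_self (fun t => g t ^ 2) volume (δ • x),
    hg.integral_sq, one_mul] at e1
  rw [integral_mul_const, integral_sub_left_eq_self (fun t => ‖g t‖) volume (δ • x)] at e2
  refine (add_le_add e1 e2).trans_eq ?_
  ring

/-- Keeping one window factor and bounding the other gives a majorant that is integrable in `Y`
first and then in both positions. It justifies exchanging `Y` with the positions. -/
theorem integrable_packet_kernel (hg : IsWindow g) (hs : UniformSymbol s) (δ : ℝ) (i : ι)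
    (u : 𝓢(V, ℂ)) :
    Integrable (Function.uncurry fun (Y : V) (p : V × V) =>
      starRingEnd ℂ (packet g δ u Y p.1) * packet g δ u Y p.2 *
        symbolKernel (s i) (δ • Y) (p.1 - p.2)) ((volume : Measure V).prod volume) := by
  obtain ⟨M, hM0, hM⟩ := hg.exists_norm_le
  obtain ⟨C, hC0, hC⟩ := hs.exists_norm_kernel_mul_pow_le 0
  have hgc := hg.smooth.continuous
  have huc := u.continuous
  have hk : Continuous fun q : V × V × V => symbolKernel (s i) (δ • q.1) (q.2.1 - q.2.2) :=
    (hs.continuous_kernel i).comp (f := fun q : V × V × V => (δ • q.1, q.2.1 - q.2.2))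
      (by fun_prop)
  have h0 : ∀ p : V × V, Integrable fun Y =>
      ‖g (δ • p.1 - Y)‖ * (‖u p.1‖ * ‖u p.2‖ * (M * C)) := fun p =>
    (hg.integrable.norm.comp_sub_left (δ • p.1)).mul_const _
  have hΘ : Integrable (fun q : V × V × V =>
      ‖g (δ • q.2.1 - q.1)‖ * (‖u q.2.1‖ * ‖u q.2.2‖ * (M * C)))
      ((volume : Measure V).prod volume) := by
    refine (integrable_prod_iff' (Continuous.aestronglyMeasurable (by fun_prop))).2
      ⟨.of_forall h0, ?_⟩
    have h1 : ∀ p : V × V, ∫ Y, ‖‖g (δ • p.1 - Y)‖ * (‖u p.1‖ * ‖u p.2‖ * (M * C))‖ =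
        (‖u p.1‖ * ‖u p.2‖) * (M * C * ∫ t, ‖g t‖) := by
      intro p
      simp only [norm_mul, norm_norm, Real.norm_of_nonneg hM0, Real.norm_of_nonneg hC0]
      rw [integral_mul_const, integral_sub_left_eq_self (fun t => ‖g t‖) volume (δ • p.1)]
      ring
    simp only [h1]
    exact (u.integrable.norm.mul_prod u.integrable.norm).mul_const _
  refine hΘ.mono' (Continuous.aestronglyMeasurable ?_) (.of_forall fun q => ?_)
  · unfold packet Function.uncurry
    fun_prop
  · simp only [Function.uncurry, norm_mul, RCLike.norm_conj]
    have h1 := norm_packet_le (δ := δ) hM u q.1 q.2.2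
    have h2 := hC i (δ • q.1) (q.2.1 - q.2.2)
    rw [pow_zero, mul_one] at h2
    calc _ ≤ ‖packet g δ u q.1 q.2.1‖ * (M * ‖u q.2.2‖) * C := by gcongr
      _ = _ := by
        rw [packet, norm_mul, Complex.norm_real]
        ring

theorem integrable_norm_sq_packetTransform (hg : IsWindow g) {δ : ℝ} (hδ : δ ≠ 0) (u : 𝓢(V, ℂ)) :
    Integrable (fun p => ‖packetTransform g δ u p‖ ^ 2) (volume : Measure (V × V)) := by
  have hF := (continuous_packetTransform (δ := δ) hg u).aestronglyMeasurable (μ := volume)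
  refine (memLp_two_iff_integrable_sq_norm hF).1 ⟨hF, ?_⟩
  have h1 := packetMeasure_univ hg hδ u
  rw [packetMeasure, withDensity_apply _ MeasurableSet.univ, Measure.restrict_univ,
    ← eLpNorm_two_sq, ← eLpNorm_two_sq] at h1
  have h2 : eLpNorm (packetTransform g δ u) 2 volume ^ 2 < ⊤ := by
    rw [h1]
    exact ENNReal.pow_lt_top (u.memLp 2 volume).2
  exact (ENNReal.pow_lt_top_iff.1 h2).resolve_right two_ne_zero

/-- For each `Y`, `integral_mul_norm_sq_fourier` trades the frequency for two positions. Integrating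
over `Y` then collects the two windows into the anti-Wick kernel. -/
theorem integral_packetMeasure (hg : IsWindow g) {δ : ℝ} (hδ : δ ≠ 0) (hs : UniformSymbol s)
    (i : ι) (u : 𝓢(V, ℂ)) :
    ∫ p, s i (δ • p.1) p.2 ∂(packetMeasure g δ u) =
      ∫ x, starRingEnd ℂ (u x) * ∫ y, antiWickKernel g δ (s i) x y * u y := by
  obtain ⟨B, hB0, hB⟩ := hs.exists_norm_le
  have hF := continuous_packetTransform (δ := δ) hg u
  have hsc : Continuous fun p : V × V => s i (δ • p.1) p.2 :=
    (hs.continuous i).comp (f := fun p : V × V => (δ • p.1, p.2)) (by fun_prop)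
  have hFint := integrable_norm_sq_packetTransform hg hδ u
  rw [Measure.volume_eq_prod] at hFint
  have hFint' : Integrable (fun p : V × V => ((‖packetTransform g δ u p‖ ^ 2 : ℝ) : ℂ))
      (volume.prod volume) := hFint.ofReal
  have hint : Integrable (fun p : V × V =>
      s i (δ • p.1) p.2 * ((‖packetTransform g δ u p‖ ^ 2 : ℝ) : ℂ)) (volume.prod volume) :=
    hFint'.bdd_mul hsc.aestronglyMeasurable (.of_forall fun p => hB i _ _)
  have hk := integrable_packet_kernel hg hs δ i u
  have e1 : ∫ p, s i (δ • p.1) p.2 ∂(packetMeasure g δ u) =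
      ∫ p : V × V, s i (δ • p.1) p.2 * ((‖packetTransform g δ u p‖ ^ 2 : ℝ) : ℂ) := by
    rw [packetMeasure, integral_withDensity_eq_integral_toReal_smul
      (hF.measurable.enorm.pow_const 2) (.of_forall fun p => by simp)]
    congr 1 with p
    rw [ENNReal.toReal_pow, toReal_enorm, Complex.real_smul, mul_comm]
  have e2 : ∀ p : V × V, ∫ Y, starRingEnd ℂ (packet g δ u Y p.1) * packet g δ u Y p.2 *
        symbolKernel (s i) (δ • Y) (p.1 - p.2) =
      starRingEnd ℂ (u p.1) * (antiWickKernel g δ (s i) p.1 p.2 * u p.2) := by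
    intro p
    rw [antiWickKernel, ← integral_mul_const, ← integral_const_mul]
    congr 1 with Y
    simp only [packet, map_mul, Complex.conj_ofReal]
    push_cast
    ring
  rw [e1, Measure.volume_eq_prod, integral_prod _ hint]
  have e3 : ∀ Y, ∫ ζ, s i (δ • Y) ζ * ((‖packetTransform g δ u (Y, ζ)‖ ^ 2 : ℝ) : ℂ) =
      ∫ p : V × V, starRingEnd ℂ (packet g δ u Y p.1) * packet g δ u Y p.2 *
        symbolKernel (s i) (δ • Y) (p.1 - p.2) := by
    intro Y
    have h5 := integral_mul_norm_sq_fourier (s := s i (δ • Y)) (w := packet g δ u Y)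
      (hs.integrable i _) (integrable_packet hg u Y)
    simp only [packetTransform, symbolKernel]
    exact h5
  simp only [e3]
  rw [integral_integral_swap hk]
  have h4 := hk.integral_prod_right
  simp only [Function.uncurry, e2] at h4 ⊢
  rw [Measure.volume_eq_prod, integral_prod _ h4]
  congr 1 with x
  exact integral_const_mul (starRingEnd ℂ (u x)) (fun y => antiWickKernel g δ (s i) x y * u y)

theorem inner_eq_integral_kernel {K : V → V → ℂ}
    {T : Lp ℂ 2 (volume : Measure V) →L[ℂ] Lp ℂ 2 (volume : Measure V)}
    (hT : ∀ u, T u =ᵐ[volume] fun x => ∫ y, K x y * u y) (u : 𝓢(V, ℂ)) :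
    ⟪u.toLp 2 volume, T (u.toLp 2 volume)⟫_ℂ =
      ∫ x, starRingEnd ℂ (u x) * ∫ y, K x y * u y := by
  rw [L2.inner_def]
  refine integral_congr_ae ?_
  filter_upwards [hT (u.toLp 2), u.coeFn_toLp 2 volume] with x h1 h2
  rw [h1, h2, RCLike.inner_apply, mul_comm]
  congr 1
  refine integral_congr_ae ?_
  filter_upwards [u.coeFn_toLp 2 volume] with y hy
  rw [hy]

/-- The Weyl quantization is asymptotic to integration against the phase space density. -/
theorem exists_norm_inner_sub_integral_packetMeasure_le (hg : IsWindow g) (hs : UniformSymbol s)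
    {ε : ℝ} (hε : 0 < ε) :
    ∃ C, 0 ≤ C ∧ ∀ i, ∀ δ ∈ Set.Ioo (0 : ℝ) 1,
      ∀ T : Lp ℂ 2 (volume : Measure V) →L[ℂ] Lp ℂ 2 (volume : Measure V),
      (∀ u, T u =ᵐ[volume] fun x => ∫ y, weylKernel (δ ^ 2) (s i) x y * u y) → ∀ u : 𝓢(V, ℂ),
      ‖⟪u.toLp 2 volume, T (u.toLp 2 volume)⟫_ℂ -
        ∫ p, s i (δ • p.1) p.2 ∂(packetMeasure g δ u)‖ ≤
          (ε + C * δ) * ‖u.toLp 2 volume‖ ^ 2 := by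
  set I := ∫ z : V, decay z
  have hI : 0 ≤ I := integral_nonneg fun z => (decay_pos z).le
  obtain ⟨C, hC0, hC⟩ := exists_norm_weylKernel_sub_antiWickKernel_le hg hs
    (ε := ε / (I + 1)) (by positivity)
  refine ⟨C * I, by positivity, fun i δ hδ T hT u => ?_⟩
  have hw : StronglyMeasurable (Function.uncurry (weylKernel (δ ^ 2) (s i))) :=
    ((hs.continuous_kernel i).comp (f := fun p : V × V =>
      ((δ ^ 2 / 2) • (p.1 + p.2), p.1 - p.2)) (by fun_prop)).stronglyMeasurable
  have hwb : ∃ B, 0 ≤ B ∧ ∀ x y, ‖weylKernel (δ ^ 2) (s i) x y‖ ≤ B * decay (x - y) := by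
    obtain ⟨B, hB0, hB⟩ := hs.exists_norm_kernel_le
    exact ⟨B, hB0, fun x y => hB i _ _⟩
  obtain ⟨B, hB0, hB⟩ := hwb
  have hδ0 := hδ.1
  have hDm := hw.sub (stronglyMeasurable_antiWickKernel hg hs δ i)
  -- `D` has the small difference kernel, so `T - D` is the anti-Wick operator and the error is the
  -- quadratic form of `D`.
  obtain ⟨D, hD, hDK⟩ := exists_kernel_operator (K := fun x y =>
    weylKernel (δ ^ 2) (s i) x y - antiWickKernel g δ (s i) x y) (by positivity) hDm (hC i δ hδ)
  have hTD : ∀ u, (T - D) u =ᵐ[volume] fun x => ∫ y, antiWickKernel g δ (s i) x y * u y := by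
    intro u
    rw [sub_apply]
    filter_upwards [hT u, hDK u, Lp.coeFn_sub (T u) (D u)] with x h1 h2 h3
    rw [h3, Pi.sub_apply, h1, h2, ← integral_sub (integrable_kernel_mul hw hB (Lp.memLp u) x)
      (integrable_kernel_mul hDm (hC i δ hδ) (Lp.memLp u) x)]
    congr 1 with y
    ring
  rw [integral_packetMeasure hg hδ0.ne' hs, ← inner_eq_integral_kernel hTD, ← inner_sub_right,
    sub_apply, sub_sub_cancel]
  refine (norm_inner_le_norm _ _).trans ?_
  have h5 : ‖D‖ ≤ ε + C * I * δ := by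
    refine hD.trans ?_
    have h6 : ε / (I + 1) * I ≤ ε := by
      rw [div_mul_eq_mul_div, div_le_iff₀ (by positivity)]
      nlinarith
    change (ε / (I + 1) + C * δ) * I ≤ _
    linarith
  calc _ ≤ ‖u.toLp 2 volume‖ * (‖D‖ * ‖u.toLp 2 volume‖) := by
        gcongr
        exact D.le_opNorm _
    _ = ‖D‖ * ‖u.toLp 2 volume‖ ^ 2 := by ring
    _ ≤ _ := by gcongr

end AntiWick

/-! ### Integration against a complex measure with a density. -/

section VectorMeasure

variable {X : Type*} [MeasurableSpace X]

theorem isFiniteMeasure_variation_withDensityᵥ {m : Measure X} {g : X → ℂ} (hg : Integrable g m) :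
    IsFiniteMeasure (m.withDensityᵥ g).variation := by
  rw [Measure.variation_withDensityᵥ hg]
  exact isFiniteMeasure_withDensity hg.2.ne

theorem simpleFunc_integral_withDensityᵥ {m : Measure X} {g : X → ℂ} (hg : Integrable g m)
    (s : SimpleFunc X ℂ) :
    ∫ᵛ x, s x ∂[ContinuousLinearMap.mul ℝ ℂ; m.withDensityᵥ g] = ∫ x, s x * g x ∂m := by
  have := isFiniteMeasure_variation_withDensityᵥ hg
  induction s using SimpleFunc.induction with
  | const c hs =>
    rename_i t
    have h1 : ⇑(SimpleFunc.piecewise t hs (SimpleFunc.const X c) (SimpleFunc.const X 0)) =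
        t.indicator fun _ => c := by
      ext x
      simp [Set.indicator, Set.piecewise]
    rw [h1]
    have h2 : ∀ x, t.indicator (fun _ => c) x * g x = t.indicator (fun x => c * g x) x := by
      intro x
      by_cases hx : x ∈ t <;> simp [hx]
    simp only [h2]
    rw [integral_indicator hs, integral_const_mul, ← withDensityᵥ_apply hg hs]
    exact setToFun_indicator_const _ hs (measure_ne_top _ _) c
  | add hfg h1 h2 =>
    rename_i s₁ s₂
    have hi : ∀ s : SimpleFunc X ℂ, Integrable s (m.withDensityᵥ g).variation := fun s =>
      SimpleFunc.integrable_of_isFiniteMeasure s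
    have hj : ∀ s : SimpleFunc X ℂ, Integrable (fun x => s x * g x) m := fun s => by
      obtain ⟨C, hC⟩ := s.exists_forall_norm_le
      exact hg.bdd_mul s.measurable.aestronglyMeasurable (.of_forall hC)
    simp only [SimpleFunc.coe_add, Pi.add_apply, add_mul]
    rw [VectorMeasure.integral_fun_add (hi s₁) (hi s₂), h1, h2, integral_add (hj s₁) (hj s₂)]

/-- Bounded simple approximations of `F` reduce to `simpleFunc_integral_withDensityᵥ`. Dominated
convergence applies on both sides, by the finite variation and by the integrability of `g`. -/
theorem integral_withDensityᵥ {m : Measure X} {g : X → ℂ} (hg : Integrable g m) {F : X → ℂ}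
    (hF : Measurable F) {B : ℝ} (hB : ∀ x, ‖F x‖ ≤ B) :
    ∫ᵛ x, F x ∂[ContinuousLinearMap.mul ℝ ℂ; m.withDensityᵥ g] = ∫ x, F x * g x ∂m := by
  have := isFiniteMeasure_variation_withDensityᵥ hg
  rcases isEmpty_or_nonempty X with hX | ⟨⟨x₀⟩⟩
  · rw [VectorMeasure.integral_of_isEmpty, integral_of_isEmpty]
  have hB0 : 0 ≤ B := (norm_nonneg _).trans (hB x₀)
  have hFs := hF.stronglyMeasurable
  have hlim := fun x => hFs.tendsto_approxBounded_of_norm_le (hB x)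
  have hbd := fun n x => hFs.norm_approxBounded_le hB0 n x
  have h1 : Tendsto (fun n => ∫ᵛ x, hFs.approxBounded B n x
      ∂[ContinuousLinearMap.mul ℝ ℂ; m.withDensityᵥ g]) atTop
      (𝓝 (∫ᵛ x, F x ∂[ContinuousLinearMap.mul ℝ ℂ; m.withDensityᵥ g])) := by
    refine VectorMeasure.tendsto_integral_of_dominated_convergence (fun _ => B)
      (fun n => ?_) (integrable_const _) (fun n => .of_forall (hbd n)) (.of_forall hlim)
    exact (SimpleFunc.measurable _).aestronglyMeasurable
  have h2 : Tendsto (fun n => ∫ x, hFs.approxBounded B n x * g x ∂m) atTop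
      (𝓝 (∫ x, F x * g x ∂m)) := by
    refine tendsto_integral_of_dominated_convergence (fun x => B * ‖g x‖)
      (fun n => (SimpleFunc.measurable _).aestronglyMeasurable.mul hg.1) (hg.norm.const_mul B)
      (fun n => .of_forall fun x => ?_) (.of_forall fun x => (hlim x).mul_const _)
    rw [norm_mul]
    gcongr
    exact hbd n x
  simp only [simpleFunc_integral_withDensityᵥ hg] at h1
  exact tendsto_nhds_unique h1 h2

end VectorMeasure

/-! ### Weak compactness of measures of bounded mass. -/

section WeakCompactness

variable {K : Type*} [TopologicalSpace K] [CompactSpace K] [TopologicalSpace.MetrizableSpace K]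
  [MeasurableSpace K] [BorelSpace K]

/-- Measures of bounded mass on a compact metrizable space have a weakly convergent subsequence; a
defect of mass is placed at `x₀`. -/
theorem exists_weak_limit (x₀ : K) {C : ℝ} (m : ℕ → Measure K)
    (hm : ∀ n, m n Set.univ ≤ ENNReal.ofReal C) :
    ∃ (φ : ℕ → ℕ) (p : Measure K), StrictMono φ ∧ IsFiniteMeasure p ∧
      ∀ F : C(K, ℂ), F x₀ = 0 →
        Tendsto (fun n => ∫ x, F x ∂(m (φ n))) atTop (𝓝 (∫ x, F x ∂p)) := by
  set c : ℝ≥0∞ := ENNReal.ofReal C + 1 with hc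
  have hc0 : c ≠ 0 := by simp [hc]
  have hct : c ≠ ⊤ := by simp [hc]
  have hmc : ∀ n, m n Set.univ ≤ c := fun n => (hm n).trans le_self_add
  have hfin : ∀ n, IsFiniteMeasure (m n) := fun n => ⟨(hm n).trans_lt ENNReal.ofReal_lt_top⟩
  -- Each measure is completed to mass `c` at `x₀` and normalized, so compactness of the space of
  -- probability measures applies. The added mass is invisible to functions vanishing at `x₀`; the
  -- `+ 1` in `c` makes it nonzero.
  let q : ℕ → Measure K := fun n => c⁻¹ • (m n + (c - m n Set.univ) • Measure.dirac x₀)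
  have hq : ∀ n, IsProbabilityMeasure (q n) := fun n => ⟨by
    simp only [q, Measure.smul_apply, Measure.add_apply, measure_univ, smul_eq_mul, mul_one]
    rw [add_tsub_cancel_of_le (hmc n), ENNReal.inv_mul_cancel hc0 hct]⟩
  obtain ⟨p, -, φ, hφ, hlim⟩ := (isCompact_univ (X := ProbabilityMeasure K)).tendsto_subseq
    (x := fun n => ⟨q n, hq n⟩) fun n => Set.mem_univ _
  refine ⟨φ, c • (p : Measure K), hφ, Measure.smul_finite _ hct, fun F hF => ?_⟩
  have h1 := (ProbabilityMeasure.tendsto_iff_forall_integral_rclike_tendsto ℂ).1 hlim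
    (BoundedContinuousFunction.mkOfCompact F)
  have h2 : ∀ n, ∫ x, F x ∂(m n) = c.toReal • ∫ x, F x ∂(q n) := by
    intro n
    have hFi : ∀ (μ : Measure K) [IsFiniteMeasure μ], Integrable F μ := fun μ _ =>
      (BoundedContinuousFunction.mkOfCompact F).integrable μ
    have hf2 : IsFiniteMeasure ((c - m n Set.univ) • Measure.dirac x₀) :=
      Measure.smul_finite _ (ne_top_of_le_ne_top hct tsub_le_self)
    simp only [q]
    rw [integral_smul_measure, integral_add_measure (hFi _) (hFi _), integral_smul_measure,
      integral_dirac, hF, smul_zero, add_zero, smul_smul, ENNReal.toReal_inv,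
      mul_inv_cancel₀ (ENNReal.toReal_ne_zero.2 ⟨hc0, hct⟩), one_smul]
  simp only [h2, integral_smul_measure]
  exact h1.const_smul _

end WeakCompactness

/-! ### Compactifying the frequency space to a closed ball. -/

section Compactification

open OpenPartialHomeomorph

variable {V : Type*} [NormedAddCommGroup V] [InnerProductSpace ℝ V]

theorem norm_univUnitBall_lt_one (ζ : V) : ‖(univUnitBall ζ : V)‖ < 1 :=
  mem_ball_zero_iff.1 (univUnitBall.map_source (Set.mem_univ ζ))

/-- The extension by zero of a function on a vector space to the closed unit ball, after the vector
space is shrunk to the open unit ball. -/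
def ballExtension {S : Type*} (A : S × V → ℂ) (q : S × V) : ℂ :=
  open Classical in if ‖q.2‖ < 1 then A (q.1, univUnitBall.symm q.2) else 0

theorem ballExtension_univUnitBall {S : Type*} (A : S × V → ℂ) (θ : S) (ζ : V) :
    ballExtension A (θ, univUnitBall ζ) = A (θ, ζ) := by
  rw [ballExtension, if_pos (norm_univUnitBall_lt_one ζ),
    univUnitBall.left_inv (Set.mem_univ ζ)]

/-- The shrinking sends `‖ζ‖ = R` to radius `R / √(1 + R²) < 1`, so a function supported in `‖ζ‖ ≤
R` extends by zero across the boundary sphere. -/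
theorem continuous_ballExtension {S : Type*} [TopologicalSpace S] {A : S × V → ℂ}
    (hA : Continuous A) (hc : HasCompactSupport A) : Continuous (ballExtension A) := by
  obtain ⟨R, hR0, hR⟩ := exists_norm_eq_zero_of_hasCompactSupport hc
  rw [continuous_iff_continuousAt]
  rintro ⟨θ, b⟩
  have hlt : IsOpen {q : S × V | ‖q.2‖ < 1} := isOpen_lt (by fun_prop) (by fun_prop)
  by_cases hb : ‖b‖ < 1
  · have h1 : ContinuousAt (fun q : S × V => A (q.1, univUnitBall.symm q.2)) (θ, b) := by
      have h2 : ContinuousAt (univUnitBall.symm : V → V) b :=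
        univUnitBall.continuousAt_symm (mem_ball_zero_iff.2 hb)
      have h3 : ContinuousAt (fun q : S × V => (q.1, univUnitBall.symm q.2)) (θ, b) :=
        continuousAt_fst.prodMk (h2.comp' continuousAt_snd)
      exact hA.continuousAt.comp h3
    refine h1.congr ?_
    filter_upwards [hlt.mem_nhds hb] with q hq
    exact (if_pos hq).symm
  · have h2 : 0 ≤ (R / √(1 + R ^ 2)) := by positivity
    have h3 : R / √(1 + R ^ 2) < 1 := by
      rw [div_lt_one (by positivity)]
      exact Real.lt_sqrt_of_sq_lt (by linarith)
    have h4 : IsOpen {q : S × V | R / √(1 + R ^ 2) < ‖q.2‖} :=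
      isOpen_lt (by fun_prop) (by fun_prop)
    refine (continuousAt_const (y := (0 : ℂ))).congr ?_
    filter_upwards [h4.mem_nhds (h3.trans_le (not_lt.1 hb))] with q hq
    rw [ballExtension]
    split_ifs with h5
    · refine (hR _ _ ?_).symm
      have h6 : 0 < 1 - ‖q.2‖ ^ 2 := by nlinarith [norm_nonneg q.2]
      have hq' : R / √(1 + R ^ 2) < ‖q.2‖ := hq
      have h7 : R ^ 2 < ‖q.2‖ ^ 2 * (1 + R ^ 2) := by
        have := mul_self_lt_mul_self h2 hq'
        rw [div_mul_div_comm, Real.mul_self_sqrt (by positivity),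
          div_lt_iff₀ (by positivity)] at this
        nlinarith
      rw [univUnitBall_symm_apply, norm_smul, norm_inv,
        Real.norm_of_nonneg (Real.sqrt_nonneg _), ← div_eq_inv_mul,
        lt_div_iff₀ (Real.sqrt_pos.2 h6)]
      refine lt_of_pow_lt_pow_left₀ 2 (norm_nonneg _) ?_
      rw [mul_pow, Real.sq_sqrt h6.le]
      nlinarith
    · rfl

theorem measurable_univUnitBall_symm [MeasurableSpace V] [BorelSpace V]
    [SecondCountableTopology V] : Measurable (univUnitBall.symm : V → V) := by
  have h : (univUnitBall.symm : V → V) = fun y => (√(1 - ‖y‖ ^ 2))⁻¹ • y :=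
    funext univUnitBall_symm_apply
  rw [h]
  fun_prop

end Compactification

/-! ### The limiting complex measure. -/

section LimitMeasure

open OpenPartialHomeomorph

variable {S V : Type*} [TopologicalSpace S] [CompactSpace S] [TopologicalSpace.MetrizableSpace S]
  [MeasurableSpace S] [BorelSpace S] [Nonempty S]
  [NormedAddCommGroup V] [InnerProductSpace ℝ V] [FiniteDimensional ℝ V]
  [MeasurableSpace V] [BorelSpace V] {Ω : Type*} [MeasurableSpace Ω]

/-- The distributions of the values of bounded functions on phase space with respect to measures of
bounded mass have a subsequence with a limit that is a complex measure. -/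
theorem exists_limit_complexMeasure {D : Set ℂ} (hD : IsCompact D) (h0 : (0 : ℂ) ∈ D) {C : ℝ}
    {ν : ℕ → Measure Ω} (hν : ∀ n, ν n Set.univ ≤ ENNReal.ofReal C) {q : ℕ → Ω → S × V}
    (hq : ∀ n, Measurable (q n)) {w : ℕ → Ω → ℂ} (hw : ∀ n, Measurable (w n))
    (hwD : ∀ n t, w n t ∈ D) :
    ∃ (φ : ℕ → ℕ) (μ : ComplexMeasure (S × V)), StrictMono φ ∧ IsFiniteMeasure μ.variation ∧
      (∀ A : S × V → ℂ, Continuous A → HasCompactSupport A →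
        Tendsto (fun n => ∫ t, A (q (φ n) t) * w (φ n) t ∂(ν (φ n))) atTop
          (𝓝 (∫ᵛ x, A x ∂[ContinuousLinearMap.mul ℝ ℂ; μ]))) ∧
      ((∀ z ∈ D, z.im = 0) → ∀ s, MeasurableSet s → (μ s).im = 0) ∧
      ((∀ z ∈ D, 0 ≤ z) → ∀ s, MeasurableSet s → 0 ≤ μ s) := by
  classical
  have := isCompact_iff_compactSpace.1 hD
  have : SecondCountableTopology S := by
    let _ := TopologicalSpace.metrizableSpaceMetric S
    infer_instance
  have : SecondCountableTopology V := inferInstance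
  let K := S × Metric.closedBall (0 : V) 1 × D
  have hKc : CompactSpace (Metric.closedBall (0 : V) 1) :=
    isCompact_iff_compactSpace.1 (isCompact_closedBall _ _)
  -- The value `w` becomes a coordinate of its own, so the integrands `A (q t) * w t` all come from
  -- one continuous function on `K`, independent of `n`.
  let κ : ℕ → Ω → K := fun n t =>
    ((q n t).1, ⟨univUnitBall (q n t).2, by
      simpa using (norm_univUnitBall_lt_one (q n t).2).le⟩, ⟨w n t, hwD n t⟩)
  have hκ : ∀ n, Measurable (κ n) := fun n =>
    (hq n).fst.prodMk ((((contDiff_univUnitBall (n := 0)).continuous.measurable).comp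
      (hq n).snd |>.subtype_mk).prodMk (hw n).subtype_mk)
  let x₀ : K := (Classical.arbitrary S, ⟨0, by simp⟩, ⟨0, h0⟩)
  obtain ⟨φ, p, hφ, hp, hlim⟩ := exists_weak_limit x₀ (C := C) (fun n => (ν n).map (κ n))
    fun n => by
      rw [Measure.map_apply (hκ n) MeasurableSet.univ, Set.preimage_univ]
      exact hν n
  let ψ : K → S × V := fun k => (k.1, univUnitBall.symm (k.2.1 : V))
  have hψ : Measurable ψ := measurable_fst.prodMk
    (measurable_univUnitBall_symm.comp (measurable_subtype_coe.comp measurable_snd.fst))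
  -- The density reads off the value coordinate and drops the mass that escaped to infinite
  -- frequency.
  let g : K → ℂ := fun k => if ‖(k.2.1 : V)‖ < 1 then (k.2.2 : ℂ) else 0
  have hgm : Measurable g := by
    refine Measurable.ite ?_ (measurable_subtype_coe.comp measurable_snd.snd) measurable_const
    exact measurableSet_lt (measurable_subtype_coe.comp measurable_snd.fst).norm measurable_const
  obtain ⟨M, hM⟩ := hD.isBounded.exists_norm_le
  have hM0 : 0 ≤ M := (norm_nonneg _).trans (hM 0 h0)
  have hg : Integrable g p := by
    refine Integrable.of_bound hgm.aestronglyMeasurable M (.of_forall fun k => ?_)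
    simp only [g]
    split_ifs
    · exact hM _ k.2.2.2
    · simpa using hM0
  have := isFiniteMeasure_variation_withDensityᵥ hg
  refine ⟨φ, (p.withDensityᵥ g).map ψ, hφ, inferInstance, fun A hA hc => ?_, fun hr s hs => ?_,
    fun hr s hs => ?_⟩
  · obtain ⟨B, hB⟩ := hc.exists_bound_of_continuous hA
    rw [VectorMeasure.integral_map hψ hA.measurable.aestronglyMeasurable
      (Integrable.of_bound (hA.measurable.comp hψ).aestronglyMeasurable B
        (.of_forall fun k => hB _)),
      integral_withDensityᵥ hg (F := fun k => A (ψ k)) (hA.measurable.comp hψ) (fun k => hB _)]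
    have hFc : Continuous fun k : K => ballExtension A (k.1, (k.2.1 : V)) * (k.2.2 : ℂ) :=
      ((continuous_ballExtension hA hc).comp (by fun_prop)).mul (by fun_prop)
    -- The value coordinate of `x₀` is `0`, so the test function vanishes there.
    have h1 := hlim ⟨_, hFc⟩ (by simp [x₀])
    convert! h1 using 2
    · rename_i n
      rw [integral_map (hκ _).aemeasurable
        (ContinuousMap.continuous _).measurable.aestronglyMeasurable]
      simp only [κ, ContinuousMap.coe_mk, ballExtension_univUnitBall]
    · congr 1 with k
      simp only [ContinuousMap.coe_mk, ballExtension, g, ψ]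
      split_ifs <;> simp
  · rw [VectorMeasure.map_apply _ hψ hs, withDensityᵥ_apply hg (hψ hs),
      ← Complex.imCLM_apply, ← ContinuousLinearMap.integral_comp_comm _ hg.integrableOn]
    refine integral_eq_zero_of_ae (.of_forall fun k => ?_)
    simp only [g, Complex.imCLM_apply, Pi.zero_apply]
    split_ifs
    · exact hr _ k.2.2.2
    · rfl
  · rw [VectorMeasure.map_apply _ hψ hs, withDensityᵥ_apply hg (hψ hs)]
    refine integral_nonneg fun k => ?_
    simp only [g, Pi.zero_apply]
    split_ifs
    · exact hr _ k.2.2.2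
    · rfl

end LimitMeasure

/-! ### Construction of the defect measure. -/

section DefectMeasure

variable {d : ℕ}

theorem IsTestFunction.hasCompactSupport_comp_scaledPolar {a : Phase d → ℂ}
    (ha : IsTestFunction a) : HasCompactSupport fun p => a (scaledPolar d p) :=
  ha.compactSupport.comp_homeomorph (scaledPolar d)

/-- Finite Borel measures on a metrizable `σ`-compact space are regular; both properties are
transported through polar coordinates. -/
instance : TopologicalSpace.MetrizableSpace (Phase d) :=
  (scaledPolar d).symm.isEmbedding.metrizableSpace

instance : SigmaCompactSpace (Phase d) :=
  (scaledPolar d).symm.isClosedEmbedding.sigmaCompactSpace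

theorem norm_inner_sub_inner_le {H : Type*} [NormedAddCommGroup H] [InnerProductSpace ℂ H]
    (T : H →L[ℂ] H) (u v : H) :
    ‖⟪u, T u⟫_ℂ - ⟪v, T v⟫_ℂ‖ ≤ ‖T‖ * (‖u‖ + ‖v‖) * ‖u - v‖ := by
  have h : ⟪u, T u⟫_ℂ - ⟪v, T v⟫_ℂ = ⟪u - v, T u⟫_ℂ + ⟪v, T (u - v)⟫_ℂ := by
    rw [inner_sub_left, map_sub, inner_sub_right]
    ring
  rw [h]
  refine (norm_add_le _ _).trans ?_
  have h1 : ‖⟪u - v, T u⟫_ℂ‖ ≤ ‖u - v‖ * (‖T‖ * ‖u‖) :=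
    (norm_inner_le_norm _ _).trans (by gcongr; exact T.le_opNorm _)
  have h2 : ‖⟪v, T (u - v)⟫_ℂ‖ ≤ ‖v‖ * (‖T‖ * ‖u - v‖) :=
    (norm_inner_le_norm _ _).trans (by gcongr; exact T.le_opNorm _)
  linarith

/-- The quadratic forms of the quantized observables are asymptotic to integrals against the phase
space densities of nearby Schwartz functions. -/
theorem tendsto_inner_op_sub_integral {f : ℝ → ℝ → ℂ} (hf : IsAdmissibleCutoff f)
    {g : Space d → ℝ} (hg : IsWindow g) {hs : ℕ → ℝ} (hs1 : ∀ n, hs n ∈ Set.Ioo (0 : ℝ) 1)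
    (hs0 : Tendsto hs atTop (𝓝 0)) {u : ℕ → L2 d} {C : ℝ} (hu : ∀ n, ‖u n‖ ≤ C)
    {v : ℕ → 𝓢(Space d, ℂ)} (hv : ∀ n, ‖u n - (v n).toLp 2 volume‖ ≤ hs n)
    (hvC : ∀ n, ‖(v n).toLp 2 volume‖ ≤ C) {a : Phase d → ℂ} (ha : IsTestFunction a) :
    Tendsto (fun n => ⟪u n, Op (f (hs n)) (hs n) a (u n)⟫_ℂ -
      ∫ p, scaledSymbol (f (hs n)) a (√(hs n) • p.1) p.2 ∂(packetMeasure g (√(hs n)) (v n)))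
      atTop (𝓝 0) := by
  obtain ⟨B, hB0, hB⟩ := exists_isWeylQuantization hf ha
  have hC0 : 0 ≤ C := (norm_nonneg _).trans (hu 0)
  rw [tendsto_zero_iff_norm_tendsto_zero]
  refine tendsto_order.2 ⟨fun b hb => .of_forall fun n => hb.trans_le (norm_nonneg _),
    fun b hb => ?_⟩
  -- After multiplication by `C ^ 2` this part of the error stays below `b / 2`; all the other error
  -- terms tend to zero.
  obtain ⟨M, hM0, hM⟩ := exists_norm_inner_sub_integral_packetMeasure_le hg
    (uniformSymbol_scaledSymbol hf ha) (ε := b / (2 * (C ^ 2 + 1))) (by positivity)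
  have hlim : Tendsto (fun n => B * (C + C) * hs n +
      (b / (2 * (C ^ 2 + 1)) + M * √(hs n)) * C ^ 2) atTop
      (𝓝 (B * (C + C) * 0 + (b / (2 * (C ^ 2 + 1)) + M * √0) * C ^ 2)) :=
    (hs0.const_mul _).add ((((Real.continuous_sqrt.tendsto 0).comp hs0).const_mul M
      |>.const_add _).mul_const _)
  have hlt : B * (C + C) * 0 + (b / (2 * (C ^ 2 + 1)) + M * √0) * C ^ 2 < b := by
    rw [Real.sqrt_zero, mul_zero, mul_zero, zero_add, add_zero, div_mul_eq_mul_div,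
      div_lt_iff₀ (by positivity)]
    nlinarith [sq_nonneg C]
  filter_upwards [hlim.eventually_lt_const hlt] with n hn
  refine lt_of_le_of_lt ?_ hn
  obtain ⟨h0, h1⟩ := hs1 n
  obtain ⟨-, hT, hTK⟩ := hB (hs n) (hs1 n)
  set T := Op (f (hs n)) (hs n) a with hTdef
  have hsq : √(hs n) ^ 2 = hs n := Real.sq_sqrt h0.le
  have e1 := hM ⟨hs n, hs1 n⟩ (√(hs n))
    ⟨Real.sqrt_pos.2 h0, (Real.sqrt_lt' one_pos).2 (by simpa using h1)⟩ T
    (by rw [hsq]; exact hTK) (v n)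
  have e2 := norm_inner_sub_inner_le T (u n) ((v n).toLp 2 volume)
  have e3 := norm_sub_le_norm_sub_add_norm_sub (⟪u n, T (u n)⟫_ℂ)
    (⟪(v n).toLp 2 volume, T ((v n).toLp 2 volume)⟫_ℂ)
    (∫ p, scaledSymbol (f (hs n)) a (√(hs n) • p.1) p.2 ∂(packetMeasure g (√(hs n)) (v n)))
  refine e3.trans (add_le_add (e2.trans ?_) (e1.trans ?_))
  · gcongr
    · exact hu n
    · exact hvC n
    · exact hv n
  · gcongr
    exact hvC n

theorem exists_schwartz_norm_sub_le (u : L2 d) {ε : ℝ} (hε : 0 < ε) :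
    ∃ v : 𝓢(Space d, ℂ), ‖u - v.toLp 2 volume‖ ≤ ε := by
  have hd : DenseRange (SchwartzMap.toLpCLM ℝ ℂ 2 (volume : Measure (Space d))) :=
    SchwartzMap.denseRange_toLpCLM (by norm_num)
  obtain ⟨v, hv⟩ := hd.exists_dist_lt u hε
  exact ⟨v, by rw [← dist_eq_norm]; exact hv.le⟩

theorem packetMeasure_univ_le {V : Type*} [NormedAddCommGroup V] [InnerProductSpace ℝ V]
    [FiniteDimensional ℝ V] [MeasurableSpace V] [BorelSpace V] {g : V → ℝ} (hg : IsWindow g)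
    {δ : ℝ} (hδ : δ ≠ 0) {v : 𝓢(V, ℂ)} {C : ℝ} (hv : ‖v.toLp 2 volume‖ ≤ C) :
    packetMeasure g δ v Set.univ ≤ ENNReal.ofReal (C ^ 2) := by
  rw [packetMeasure_univ hg hδ, ← eLpNorm_two_sq, ENNReal.ofReal_pow ((norm_nonneg _).trans hv)]
  gcongr
  rw [← eLpNorm_congr_ae (v.coeFn_toLp 2 volume),
    ENNReal.le_ofReal_iff_toReal_le (Lp.eLpNorm_ne_top _) ((norm_nonneg _).trans hv)]
  exact hv

theorem exists_defect_measure {f : ℝ → ℝ → ℂ} (hf : IsAdmissibleCutoff f) {u : ℝ → L2 d} {C : ℝ}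
    (hu : ∀ h ∈ Set.Ioo (0 : ℝ) 1, ‖u h‖ ≤ C) :
    ∃ (hseq : ℕ → ℝ) (μ : ComplexMeasure (Phase d)),
      (∀ m, hseq m ∈ Set.Ioo (0 : ℝ) 1) ∧ Tendsto hseq atTop (𝓝 0) ∧
      IsFiniteMeasure μ.variation ∧
      (∀ a : Phase d → ℂ, IsTestFunction a →
        Tendsto (fun m => ⟪u (hseq m), Op (f (hseq m)) (hseq m) a (u (hseq m))⟫_ℂ)
          atTop (𝓝 (∫ᵛ p, a p ∂[ContinuousLinearMap.mul ℝ ℂ; μ]))) ∧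
      ((∀ h ∈ Set.Ioo (0 : ℝ) 1, ∀ r, (f h r).im = 0) → ∀ s, MeasurableSet s → (μ s).im = 0) ∧
      ((∀ h ∈ Set.Ioo (0 : ℝ) 1, ∀ r, 0 ≤ f h r) → ∀ s, MeasurableSet s → 0 ≤ μ s) := by
  obtain ⟨g, hg⟩ := exists_isWindow (Space d)
  -- The shift by `2` keeps the first term strictly below `1`.
  let hs : ℕ → ℝ := fun n => 1 / ((n : ℝ) + 2)
  have hs1 : ∀ n, hs n ∈ Set.Ioo (0 : ℝ) 1 := fun n => by
    refine ⟨by positivity, ?_⟩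
    rw [div_lt_one (by positivity)]
    linarith [(Nat.cast_nonneg n : (0 : ℝ) ≤ n)]
  have hs0 : Tendsto hs atTop (𝓝 0) :=
    tendsto_const_nhds.div_atTop (tendsto_atTop_add_const_right _ _ tendsto_natCast_atTop_atTop)
  choose v hv using fun n => exists_schwartz_norm_sub_le (u (hs n)) (hs1 n).1
  have hvC : ∀ n, ‖(v n).toLp 2 volume‖ ≤ C + 1 := fun n => by
    have h1 := norm_le_norm_add_norm_sub (u (hs n)) ((v n).toLp 2 volume)
    linarith [hu _ (hs1 n), hv n, (hs1 n).2]
  have huC : ∀ n, ‖u (hs n)‖ ≤ C + 1 := fun n => by linarith [hu _ (hs1 n)]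
  have hδ : ∀ n, √(hs n) ≠ 0 := fun n => (Real.sqrt_pos.2 (hs1 n).1).ne'
  obtain ⟨M, hM0, hM⟩ := hf.exists_bound
  -- Its closure is the compact set of values. It contains `0` since the cutoffs vanish at `r = 0`,
  -- and it keeps any closed condition on the values, such as being real or nonnegative.
  let R : Set ℂ := {z | ∃ h ∈ Set.Ioo (0 : ℝ) 1, ∃ r, f h r = z}
  have hR : R ⊆ Metric.closedBall 0 M := by
    rintro z ⟨h, hh, r, rfl⟩
    simpa using hM h hh r
  have hD : IsCompact (closure R) :=
    ((isCompact_closedBall (0 : ℂ) M).isBounded.subset hR).isCompact_closure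
  have : Nonempty (UnitSphere d) := ⟨unitDir 0⟩
  obtain ⟨φ, μ, hφ, hμ, hlim, him, hnn⟩ := exists_limit_complexMeasure hD
    (subset_closure ⟨hs 0, hs1 0, 0, hf.map_zero (hs1 0)⟩)
    (fun n => packetMeasure_univ_le hg (hδ n) (hvC n))
    (q := fun n (p : Space d × Space d) => (unitDir (√(hs n) • p.1), p.2))
    (fun n => (measurable_unitDir.comp (by fun_prop)).prodMk measurable_snd)
    (w := fun n p => f (hs n) ‖√(hs n) • p.1‖)
    (fun n => (hf.smooth _ (hs1 n)).continuous.measurable.comp (by fun_prop))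
    (fun n p => subset_closure ⟨hs n, hs1 n, _, rfl⟩)
  let e := (scaledPolar d).toMeasurableEquiv
  refine ⟨fun m => hs (φ m), μ.map e, fun m => hs1 _, hs0.comp hφ.tendsto_atTop, inferInstance,
    fun a ha => ?_, fun hr s hsm => ?_, fun hr s hsm => ?_⟩
  · rw [VectorMeasure.integral_map_equiv]
    have h1 := hlim (fun p => a (scaledPolar d p))
      (ha.smooth.continuous.comp (scaledPolar d).continuous) ha.hasCompactSupport_comp_scaledPolar
    have h2 := (tendsto_inner_op_sub_integral hf hg hs1 hs0 huC hv hvC ha).comp hφ.tendsto_atTop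
    have h3 := h2.add h1
    rw [zero_add] at h3
    refine h3.congr fun n => ?_
    simp only [Function.comp_apply, scaledSymbol_eq (hf.map_zero (hs1 _)),
      mul_comm (f _ _), sub_add_cancel]
  · rw [VectorMeasure.map_apply _ e.measurable hsm]
    refine him (fun z hz => ?_) _ (e.measurable hsm)
    have hcl : IsClosed {z : ℂ | z.im = 0} := isClosed_eq Complex.continuous_im continuous_const
    refine closure_minimal ?_ hcl hz
    rintro _ ⟨h, hh, r, rfl⟩
    exact hr h hh r
  · rw [VectorMeasure.map_apply _ e.measurable hsm]
    refine hnn (fun z hz => ?_) _ (e.measurable hsm)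
    refine closure_minimal ?_ isClosed_Ici hz
    rintro _ ⟨h, hh, r, rfl⟩
    exact hr h hh r

end DefectMeasure

end DefectMeasure

end

theorem theorem1p1 (d : ℕ) (f : ℝ → ℝ → ℂ) (hf : DefectMeasure.IsAdmissibleCutoff f)
    (u : ℝ → DefectMeasure.L2 d)
    (hu : ∃ C : ℝ, ∀ h ∈ Set.Ioo (0 : ℝ) 1, ‖u h‖ ≤ C) :
    (∀ h ∈ Set.Ioo (0 : ℝ) 1, ∀ a : DefectMeasure.Phase d → ℂ, DefectMeasure.IsTestFunction a →
      DefectMeasure.IsWeylQuantization h (DefectMeasure.symbol (f h) a)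
        (DefectMeasure.Op (f h) h a)) ∧
    ∃ (hseq : ℕ → ℝ) (μ : ComplexMeasure (DefectMeasure.Phase d)),
      (∀ m, hseq m ∈ Set.Ioo (0 : ℝ) 1) ∧
      Tendsto hseq atTop (𝓝 0) ∧
      IsFiniteMeasure μ.variation ∧ μ.variation.Regular ∧
      (∀ a : DefectMeasure.Phase d → ℂ, DefectMeasure.IsTestFunction a →
        Tendsto (fun m => ⟪u (hseq m), DefectMeasure.Op (f (hseq m)) (hseq m) a (u (hseq m))⟫_ℂ)
          atTop (𝓝 (∫ᵛ p, a p ∂[ContinuousLinearMap.mul ℝ ℂ; μ]))) ∧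
      ((∀ h ∈ Set.Ioo (0 : ℝ) 1, ∀ r, (f h r).im = 0) → ∀ s, MeasurableSet s → (μ s).im = 0) ∧
      ((∀ h ∈ Set.Ioo (0 : ℝ) 1, ∀ r, 0 ≤ f h r) → ∀ s, MeasurableSet s → 0 ≤ μ s) := by
  obtain ⟨C, hC⟩ := hu
  obtain ⟨hseq, μ, h1, h2, h3, h4, h5, h6⟩ := DefectMeasure.exists_defect_measure hf hC
  refine ⟨fun h hh a ha => ?_, hseq, μ, h1, h2, h3, inferInstance, h4, h5, h6⟩
  obtain ⟨_, _, hB⟩ := DefectMeasure.exists_isWeylQuantization hf ha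
  exact (hB h hh).1
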